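/- Let $\gamma$ be a smooth left-invariant Riemannian metric on the Lie group $SU(2)$, let $X$ be a smooth vector field on $SU(2)$ (not assumed to be Killing or left-invariant), and let $m>0$ and $\Lambda$ be real constants such that the near-horizon (quasi-Einstein) equation $$\mathrm{Ric}+\tfrac12\,\mathcal L_X\gamma-\tfrac1m\,X^\flat\otimes X^\flat=\Lambda\,\gamma$$ holds, where $\mathrm{Ric}$ is the Ricci tensor of $\gamma$ and $X^\flat=\gamma(X,\cdot)$. Then: 1. The isometry group of $(SU(2),\gamma)$ contains $SU(2)\times U(1)$, up to its central subgroup of order two $\{(1,1),(-1,-1)\}$. That is, there is a smooth action of $SU(2)\times U(1)$ on $SU(2)$ by isometries of $\gamma$, in which the factor $SU(2)$ acts by left translations, and the elements acting trivially are exactly $(1,1)$ and $(-1,-1)$; its image in the isometry group is a copy of $(SU(2)\times U(1))/\{\pm(1,1)\}\cong U(2)$. 2. $\gamma$ is a Berger sphere metric. That is, there are a basis $\sigma_1,\sigma_2,\sigma_3$ of the left-invariant vector fields with $[\sigma_i,\sigma_{i+1}]=2\sigma_{i+2}$ (indices mod $3$), with dual coframe $\sigma^1,\sigma^2,\sigma^3$,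 a constant $c>0$ and constants $\varepsilon,\beta\in(0,1]$ such that $$\gamma=c\left(\varepsilon^2\,\sigma^1\otimes\sigma^1+\beta^2\,\sigma^2\otimes\sigma^2+\sigma^3\otimes\sigma^3\right)$$ and at least two of the three coefficients are equal: $\beta=1$, or $\varepsilon=1$, or $\varepsilon=\beta$. (The round metric is included.) -/

import Mathlib

open Bundle Module
open scoped Manifold ContDiff Matrix

noncomputable section

/-! ## Riemannian geometry on a smooth manifold -/

section Riemannian

variable {E : Type*} [NormedAddCommGroup E] [NormedSpace ℝ E]
  {H : Type*} [TopologicalSpace H] {I : ModelWithCorners ℝ E H}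
  {M : Type*} [TopologicalSpace M] [ChartedSpace H M] [IsManifold I ∞ M]

/-- Smooth (`C^∞`) Riemannian metrics on the manifold `M`. -/
abbrev SmoothMetric (I : ModelWithCorners ℝ E H) (M : Type*) [TopologicalSpace M]
    [ChartedSpace H M] [IsManifold I ∞ M] : Type _ :=
  ContMDiffRiemannianMetric (IB := I) (n := ∞) (F := E) (E := (TangentSpace I : M → Type _))

/-- The vector field `V` on `M` is smooth (`C^∞`). -/
def IsSmoothField (V : Π p : M, TangentSpace I p) : Prop :=
  ContMDiff I I.tangent ∞ (fun p ↦ (⟨p, V p⟩ : TangentBundle I M))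

/-- The function `p ↦ γ_p(V_p, W_p)`. -/
def SmoothMetric.pair (γ : SmoothMetric I M) (V W : Π p : M, TangentSpace I p) : M → ℝ :=
  fun p ↦ γ.inner p (V p) (W p)

/-- `∇` is the Levi-Civita connection of `γ`: it is torsion free and
`v(γ(Y,Z)) = γ(∇_v Y, Z) + γ(Y, ∇_v Z)`.  (In Mathlib `∇ Y p v` stands for `(∇_v Y)(p)`.) -/
structure IsLeviCivita [FiniteDimensional ℝ E] (γ : SmoothMetric I M)
    (nabla : CovariantDerivative I E (TangentSpace I : M → Type _)) : Prop where
  torsion_free : nabla.torsion = 0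
  metric : ∀ (Y Z : Π p : M, TangentSpace I p) (p : M),
    MDifferentiableAt I I.tangent (fun q ↦ (⟨q, Y q⟩ : TangentBundle I M)) p →
    MDifferentiableAt I I.tangent (fun q ↦ (⟨q, Z q⟩ : TangentBundle I M)) p →
    ∀ v : TangentSpace I p,
      mvfderiv I (γ.pair Y Z) p v
        = γ.inner p (nabla Y p v) (Z p) + γ.inner p (Y p) (nabla Z p v)

/-- `R(U,V)W = ∇_U ∇_V W - ∇_V ∇_U W - ∇_{[U,V]} W`, at the point `p`. -/
def curvatureAt (nabla : CovariantDerivative I E (TangentSpace I : M → Type _))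
    (U V W : Π p : M, TangentSpace I p) (p : M) : TangentSpace I p :=
  nabla (fun q ↦ nabla W q (V q)) p (U p) - nabla (fun q ↦ nabla W q (U q)) p (V p)
    - nabla W p (VectorField.mlieBracket I U V p)

/-- The Ricci curvature `Ric(Y,Z)(p) = tr (u ↦ R(u,Y)Z)` for vector fields `Y`, `Z`.  The
endomorphism `u ↦ R(u,Y)Z` of `T_p M` is given by its values on a basis of `T_p M`, each basis
vector being extended to a vector field near `p`; as `R` is a tensor, neither the basis nor the
extension matters. -/
def ricciAt [FiniteDimensional ℝ E]
    (nabla : CovariantDerivative I E (TangentSpace I : M → Type _))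
    (Y Z : Π p : M, TangentSpace I p) (p : M) : ℝ :=
  let b : Basis (Fin (finrank ℝ E)) ℝ (TangentSpace I p) := finBasis ℝ E
  LinearMap.trace ℝ (TangentSpace I p)
    (b.constr ℝ fun i ↦ curvatureAt nabla (FiberBundle.extend E (b i)) Y Z p)

/-- The Lie derivative of the metric,
`(£_X γ)(Y,Z) = X(γ(Y,Z)) - γ([X,Y],Z) - γ(Y,[X,Z])`, at the point `p`. -/
def lieDerivMetricAt (γ : SmoothMetric I M) (X Y Z : Π p : M, TangentSpace I p) (p : M) : ℝ :=
  mvfderiv I (γ.pair Y Z) p (X p)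
    - γ.inner p (VectorField.mlieBracket I X Y p) (Z p)
    - γ.inner p (Y p) (VectorField.mlieBracket I X Z p)

/-- The near-horizon (quasi-Einstein) equation
`Ric + (1/2) £_X γ - (1/m) X ⊗ X = Λ γ`, tested on all smooth vector fields `Y`, `Z`.
`X` is the vector field; the `1`-form in `X ⊗ X` is its metric dual `γ(X, ·)`. -/
def SolvesNearHorizon [FiniteDimensional ℝ E] (γ : SmoothMetric I M)
    (X : Π p : M, TangentSpace I p) (m Λ : ℝ) : Prop :=
  ∃ nabla : CovariantDerivative I E (TangentSpace I : M → Type _), IsLeviCivita γ nabla ∧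
    ∀ Y Z : Π p : M, TangentSpace I p, IsSmoothField Y → IsSmoothField Z → ∀ p : M,
      ricciAt nabla Y Z p + 1 / 2 * lieDerivMetricAt γ X Y Z p
          - 1 / m * (γ.pair X Y p * γ.pair X Z p)
        = Λ * γ.pair Y Z p

/-- The map `φ` preserves the metric: `φ^* γ = γ`. -/
def PreservesMetric (γ : SmoothMetric I M) (φ : M → M) : Prop :=
  ∀ (p : M) (v w : TangentSpace I p),
    γ.inner (φ p) (mfderiv I I φ p v) (mfderiv I I φ p w) = γ.inner p v w

/-- The isometry group of `(M, γ)`: all diffeomorphisms `φ` of `M` with `φ^* γ = γ`. -/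
def isometryGroup (γ : SmoothMetric I M) : Subgroup (Equiv.Perm M) where
  carrier := {φ | ContMDiff I I ∞ φ ∧ ContMDiff I I ∞ φ.symm ∧ PreservesMetric γ φ}
  one_mem' := by
    refine ⟨contMDiff_id, contMDiff_id, fun p v w ↦ ?_⟩
    have h : mfderiv I I (⇑(1 : Equiv.Perm M)) p = ContinuousLinearMap.id ℝ _ := mfderiv_id
    rw [h]; rfl
  mul_mem' := by
    rintro φ ψ ⟨h1, h2, h3⟩ ⟨k1, k2, k3⟩
    refine ⟨h1.comp k1, k2.comp h2, fun p v w ↦ ?_⟩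
    have h : mfderiv I I (⇑(φ * ψ)) p = (mfderiv I I φ (ψ p)).comp (mfderiv I I ψ p) :=
      mfderiv_comp p ((h1 (ψ p)).mdifferentiableAt (by simp)) ((k1 p).mdifferentiableAt (by simp))
    rw [h]
    exact (h3 (ψ p) _ _).trans (k3 p v w)
  inv_mem' := by
    rintro φ ⟨h1, h2, h3⟩
    refine ⟨h2, h1, fun p v w ↦ ?_⟩
    have hc : (φ : M → M) ∘ (⇑φ⁻¹ : M → M) = id := by ext x; simp
    have hp : φ (φ⁻¹ p) = p := φ.apply_symm_apply p
    have key : (mfderiv I I φ (φ⁻¹ p)).comp (mfderiv I I (⇑φ⁻¹) p)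
        = mfderiv I I (id : M → M) p := by
      rw [← hc]
      exact (mfderiv_comp p ((h1 (φ⁻¹ p)).mdifferentiableAt (by simp))
        ((h2 p).mdifferentiableAt (by simp))).symm
    have hk : ∀ u : TangentSpace I p,
        mfderiv I I φ (φ⁻¹ p) (mfderiv I I (⇑φ⁻¹) p u) = (u : E) := by
      intro u
      have := DFunLike.congr_fun key u
      rw [mfderiv_id] at this
      exact this
    have transport : ∀ (q : M) (_ : q = p) (a b : E),
        γ.inner q (a : TangentSpace I q) (b : TangentSpace I q)
          = γ.inner p (a : TangentSpace I p) (b : TangentSpace I p) := by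
      rintro q rfl a b; rfl
    have h4 := h3 (φ⁻¹ p) (mfderiv I I (⇑φ⁻¹) p v) (mfderiv I I (⇑φ⁻¹) p w)
    refine h4.symm.trans ?_
    refine Eq.trans ?_ (transport _ hp v w)
    exact congrArg₂ (fun a b : E ↦ γ.inner (φ (φ⁻¹ p)) (a : TangentSpace I (φ (φ⁻¹ p)))
      (b : TangentSpace I (φ (φ⁻¹ p)))) (hk v) (hk w)

end Riemannian

/-! ## Left-invariant metrics on a Lie group -/

section LieGroup

variable {E : Type*} [NormedAddCommGroup E] [NormedSpace ℝ E]
  {H : Type*} [TopologicalSpace H] {I : ModelWithCorners ℝ E H}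
  {G : Type*} [TopologicalSpace G] [ChartedSpace H G] [Group G] [IsManifold I ∞ G]

/-- The metric `γ` is left-invariant: every left translation preserves it. -/
def IsLeftInvariantMetric (γ : SmoothMetric I G) : Prop :=
  ∀ g : G, PreservesMetric γ (fun x ↦ g * x)

end LieGroup

/-! ## The Lie group `SU(2)` -/

/-- The group of unitary complex `2 × 2` matrices of determinant one. -/
abbrev SU2 : Type := Matrix.specialUnitaryGroup (Fin 2) ℂ

namespace SU2

/-- The unit sphere of `ℝ⁴`. -/
abbrev S3 : Type := Metric.sphere (0 : EuclideanSpace ℝ (Fin (3 + 1))) 1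

/-- The first column `(a, b)` of a matrix, as the vector `(Re a, Im a, Re b, Im b)` of `ℝ⁴`. -/
def col (A : Matrix (Fin 2) (Fin 2) ℂ) : EuclideanSpace ℝ (Fin (3 + 1)) :=
  !₂[(A 0 0).re, (A 0 0).im, (A 1 0).re, (A 1 0).im]

/-- The matrix with rows `(a, -b̄)`, `(b, ā)`, where `a = v₀ + i v₁` and `b = v₂ + i v₃`. -/
def mat (v : EuclideanSpace ℝ (Fin (3 + 1))) : Matrix (Fin 2) (Fin 2) ℂ :=
  !![⟨v 0, v 1⟩, ⟨-v 2, v 3⟩; ⟨v 2, v 3⟩, ⟨v 0, -v 1⟩]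

lemma mem_S3_iff (v : EuclideanSpace ℝ (Fin (3 + 1))) :
    v ∈ Metric.sphere (0 : EuclideanSpace ℝ (Fin (3 + 1))) 1 ↔
      v 0 ^ 2 + v 1 ^ 2 + v 2 ^ 2 + v 3 ^ 2 = 1 := by
  rw [mem_sphere_zero_iff_norm, EuclideanSpace.norm_eq, Real.sqrt_eq_one]
  simp [Fin.sum_univ_four]

lemma mat_mem {v : EuclideanSpace ℝ (Fin (3 + 1))}
    (hv : v 0 ^ 2 + v 1 ^ 2 + v 2 ^ 2 + v 3 ^ 2 = 1) :
    mat v ∈ Matrix.specialUnitaryGroup (Fin 2) ℂ := by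
  rw [Matrix.mem_specialUnitaryGroup_iff, Matrix.mem_unitaryGroup_iff]
  constructor
  · ext i j
    fin_cases i <;> fin_cases j <;>
      simp [mat, Matrix.mul_apply, Fin.sum_univ_two, Complex.ext_iff, Matrix.star_apply] <;>
      (constructor <;> nlinarith)
  · simp [mat, Matrix.det_fin_two, Complex.ext_iff]
    constructor <;> nlinarith

lemma mat_col (A : SU2) : mat (col A.1) = A.1 := by
  have h : (A⁻¹ : SU2).1 * A.1 = 1 := congrArg Subtype.val (inv_mul_cancel A)
  have hadj : A.1.adjugate = star A.1 := by
    have h1 : A.1 * star A.1 = 1 := Matrix.mem_unitaryGroup_iff.1 A.2.1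
    have h2 : A.1.adjugate * A.1 = 1 := by
      rw [Matrix.adjugate_mul, show A.1.det = 1 from A.2.2, one_smul]
    calc A.1.adjugate = A.1.adjugate * (A.1 * star A.1) := by rw [h1, mul_one]
      _ = star A.1 := by rw [← mul_assoc, h2, one_mul]
  have e00 := congrFun (congrFun hadj 0) 0
  have e01 := congrFun (congrFun hadj 1) 0
  simp [Matrix.adjugate_fin_two, Matrix.star_apply, Complex.ext_iff] at e00 e01
  ext i j
  fin_cases i <;> fin_cases j <;> simp [mat, col, Complex.ext_iff] <;>
    constructor <;> linarith [e00.1, e00.2, e01.1, e01.2]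

lemma col_mat (v : EuclideanSpace ℝ (Fin (3 + 1))) : col (mat v) = v := by
  ext i
  fin_cases i <;> simp [mat, col]

lemma col_mem (A : SU2) : col A.1 ∈ Metric.sphere (0 : EuclideanSpace ℝ (Fin (3 + 1))) 1 := by
  rw [mem_S3_iff]
  have h : A.1.det = 1 := A.2.2
  rw [← mat_col A] at h
  simp [mat, Matrix.det_fin_two, Complex.ext_iff] at h
  nlinarith [h.1]

/-- The homeomorphism of `SU(2)` with the unit sphere of `ℝ⁴` given by the first column. -/
def homeo : SU2 ≃ₜ S3 where
  toFun A := ⟨col A.1, col_mem A⟩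
  invFun v := ⟨mat v.1, mat_mem ((mem_S3_iff _).1 v.2)⟩
  left_inv A := Subtype.ext (mat_col A)
  right_inv v := Subtype.ext (col_mat v.1)
  continuous_toFun := by
    refine Continuous.subtype_mk ?_ _
    unfold col
    have h (i j : Fin 2) : Continuous fun A : SU2 ↦ A.1 i j :=
      continuous_subtype_val.matrix_elem i j
    refine (PiLp.continuous_toLp 2 _).comp (continuous_pi fun i ↦ ?_)
    fin_cases i
    · exact Complex.continuous_re.comp (h 0 0)
    · exact Complex.continuous_im.comp (h 0 0)
    · exact Complex.continuous_re.comp (h 1 0)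
    · exact Complex.continuous_im.comp (h 1 0)
  continuous_invFun := by
    refine Continuous.subtype_mk (continuous_matrix fun i j ↦ ?_) _
    have h (k l : Fin (3 + 1)) (s : ℝ) : Continuous fun v : S3 ↦ (⟨v.1 k, s * v.1 l⟩ : ℂ) := by
      have : Continuous fun v : S3 ↦ ((v.1 k : ℂ) + (s * v.1 l : ℝ) * Complex.I) := by fun_prop
      refine this.congr fun v ↦ ?_
      simp [Complex.ext_iff]
    have h' : Continuous fun v : S3 ↦ (⟨-v.1 2, v.1 3⟩ : ℂ) := by
      refine (h 2 3 (-1)).neg.congr fun v ↦ ?_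
      simp [Complex.ext_iff]
    fin_cases i <;> fin_cases j
    · simpa [mat] using h 0 1 1
    · simpa [mat] using h'
    · simpa [mat] using h 2 3 1
    · simpa [mat] using h 0 1 (-1)

/-- The smooth structure of `SU(2)`, transported from the unit sphere of `ℝ⁴`. -/
instance : ChartedSpace (EuclideanSpace ℝ (Fin 3)) SU2 where
  atlas := {e | ∃ c ∈ atlas (EuclideanSpace ℝ (Fin 3)) S3, e = homeo.transOpenPartialHomeomorph c}
  chartAt A := homeo.transOpenPartialHomeomorph (chartAt _ (homeo A))
  mem_chart_source _ := mem_chart_source (EuclideanSpace ℝ (Fin 3)) (homeo _)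
  chart_mem_atlas _ := ⟨_, chart_mem_atlas _ _, rfl⟩

instance : IsManifold (𝓡 3) ω SU2 where
  compatible := by
    rintro _ _ ⟨c, hc, rfl⟩ ⟨c', hc', rfl⟩
    refine StructureGroupoid.mem_of_eqOnSource _
      ((contDiffGroupoid ω (𝓡 3)).compatible hc hc') ?_
    constructor
    · ext x
      simp [Homeomorph.transOpenPartialHomeomorph_eq_trans]
    · intro x hx
      simp [Homeomorph.transOpenPartialHomeomorph_eq_trans]

lemma contMDiff_homeo {n : ℕ∞ω} : ContMDiff (𝓡 3) (𝓡 3) n homeo := by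
  have : ContMDiff (𝓡 3) (𝓡 3) ω homeo := by
    refine contMDiff_iff.2 ⟨homeo.continuous, fun x y ↦ ?_⟩
    refine ((contMDiff_iff.1 (contMDiff_id (I := 𝓡 3) (M := S3) (n := ω))).2
      (homeo x) y).congr_mono (fun z _ ↦ ?_) (fun z hz ↦ ?_)
    · exact congrArg (extChartAt (𝓡 3) y) (homeo.apply_symm_apply _)
    · have h2 := hz.2
      exact ⟨hz.1, (congrArg (· ∈ (extChartAt (𝓡 3) y).source)
        (homeo.apply_symm_apply ((extChartAt (𝓡 3) (homeo x)).symm z))).mp h2⟩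
  exact this.of_le le_top

lemma contMDiff_homeo_symm {n : ℕ∞ω} : ContMDiff (𝓡 3) (𝓡 3) n homeo.symm := by
  have : ContMDiff (𝓡 3) (𝓡 3) ω homeo.symm := by
    refine contMDiff_iff.2 ⟨homeo.symm.continuous, fun x y ↦ ?_⟩
    refine ((contMDiff_iff.1 (contMDiff_id (I := 𝓡 3) (M := S3) (n := ω))).2
      x (homeo y)).congr_mono (fun z _ ↦ ?_) (fun z hz ↦ ?_)
    · exact congrArg (extChartAt (𝓡 3) (homeo y)) (homeo.apply_symm_apply _)
    · have h2 := hz.2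
      exact ⟨hz.1, (congrArg (· ∈ (extChartAt (𝓡 3) (homeo y)).source)
        (homeo.apply_symm_apply ((extChartAt (𝓡 3) x).symm z))).mp h2⟩
  exact this.of_le le_top

lemma contMDiff_col {n : ℕ∞ω} :
    ContMDiff (𝓡 3) 𝓘(ℝ, EuclideanSpace ℝ (Fin (3 + 1))) n (fun A : SU2 ↦ col A.1) :=
  have := Fact.mk (@finrank_euclideanSpace_fin ℝ _ (3 + 1))
  (contMDiff_coe_sphere (E := EuclideanSpace ℝ (Fin (3 + 1)))).comp contMDiff_homeo

/-- A map into `SU(2)` is smooth as soon as the matrix entries of its values are. -/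
lemma contMDiff_of_col {E' H' N : Type*} [NormedAddCommGroup E'] [NormedSpace ℝ E']
    [TopologicalSpace H'] {J : ModelWithCorners ℝ E' H'} [TopologicalSpace N] [ChartedSpace H' N]
    {n : ℕ∞ω} [IsManifold J n N] {f : N → SU2}
    (hf : ContMDiff J 𝓘(ℝ, EuclideanSpace ℝ (Fin (3 + 1))) n (fun x ↦ col (f x).1)) :
    ContMDiff J (𝓡 3) n f := by
  have := Fact.mk (@finrank_euclideanSpace_fin ℝ _ (3 + 1))
  have h := (contMDiff_homeo_symm (n := n)).comp (hf.codRestrict_sphere fun x ↦ col_mem (f x))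
  refine h.congr fun x ↦ ?_
  exact (homeo.symm_apply_apply (f x)).symm

instance : LieGroup (𝓡 3) ω SU2 where
  contMDiff_mul := by
    apply contMDiff_of_col
    have h : ContMDiff (𝓘(ℝ, EuclideanSpace ℝ (Fin (3 + 1))).prod
        𝓘(ℝ, EuclideanSpace ℝ (Fin (3 + 1)))) 𝓘(ℝ, EuclideanSpace ℝ (Fin (3 + 1))) ω
        (fun p : EuclideanSpace ℝ (Fin (3 + 1)) × EuclideanSpace ℝ (Fin (3 + 1)) ↦
          col (mat p.1 * mat p.2)) := by
      rw [← modelWithCornersSelf_prod, chartedSpaceSelf_prod, contMDiff_iff_contDiff,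
        contDiff_euclidean]
      intro i
      fin_cases i <;> simp [col, mat, Matrix.mul_apply, Fin.sum_univ_two] <;> fun_prop
    refine (h.comp (contMDiff_col.prodMap contMDiff_col)).congr fun p ↦ ?_
    simp [mat_col]
  contMDiff_inv := by
    apply contMDiff_of_col
    have h : ContMDiff 𝓘(ℝ, EuclideanSpace ℝ (Fin (3 + 1)))
        𝓘(ℝ, EuclideanSpace ℝ (Fin (3 + 1))) ω
        (fun v : EuclideanSpace ℝ (Fin (3 + 1)) ↦ col (star (mat v))) := by
      rw [contMDiff_iff_contDiff, contDiff_euclidean]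
      intro i
      fin_cases i <;> simp [col, mat, Matrix.star_apply] <;> fun_prop
    refine (h.comp contMDiff_col).congr fun A ↦ ?_
    simp [mat_col, ← Matrix.star_eq_inv]

end SU2

/-! ## Berger spheres and the symmetry `SU(2) × U(1)` -/

/-- `γ` is a Berger sphere metric on `SU(2)`: there is a basis `σ₀, σ₁, σ₂` of the left-invariant
vector fields with `[σ_i, σ_{i+1}] = 2 σ_{i+2}` (indices mod 3) such that, up to the homothety
factor `c > 0`, `γ = ε² σ⁰ ⊗ σ⁰ + β² σ¹ ⊗ σ¹ + σ² ⊗ σ²` in the dual coframe, with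
`ε, β ∈ (0, 1]` and two of the three coefficients equal. -/
def IsBergerMetric (γ : SmoothMetric (𝓡 3) SU2) : Prop :=
  ∃ (c ε β : ℝ) (σ : Basis (Fin 3) ℝ (GroupLieAlgebra (𝓡 3) SU2)),
    0 < c ∧ (0 < ε ∧ ε ≤ 1) ∧ (0 < β ∧ β ≤ 1) ∧
    (∀ i : Fin 3, ⁅σ i, σ (i + 1)⁆ = (2 : ℝ) • σ (i + 2)) ∧
    (∀ (g : SU2) (i j : Fin 3),
      γ.inner g (mulInvariantVectorField (σ i) g) (mulInvariantVectorField (σ j) g)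
        = if i = j then c * ![ε ^ 2, β ^ 2, 1] i else 0) ∧
    (β = 1 ∨ ε = 1 ∨ ε = β)

/-- `SU(2) × U(1)` is contained in the isometry group of `γ`, in the usual sense up to its central
subgroup `{(1, 1), (-1, -1)}`: it acts smoothly on `SU(2)` by isometries of `γ`, the factor `SU(2)`
acting by left translations, and the pairs acting trivially are exactly `(1, 1)` and `(-1, -1)`.
So the image in the isometry group is a copy of `(SU(2) × U(1)) / {±(1, 1)} ≅ U(2)`. -/
def IsometryGroupContainsSU2U1 (γ : SmoothMetric (𝓡 3) SU2) : Prop :=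
  ∃ Φ : SU2 × Circle →* isometryGroup γ,
    ContMDiff (((𝓡 3).prod (𝓡 1)).prod (𝓡 3)) (𝓡 3) ∞
      (fun q : (SU2 × Circle) × SU2 ↦ (Φ q.1 : Equiv.Perm SU2) q.2) ∧
    (∀ g x : SU2, (Φ (g, 1) : Equiv.Perm SU2) x = g * x) ∧
    (∀ (g : SU2) (z : Circle),
      Φ (g, z) = 1 ↔ (g = 1 ∧ z = 1) ∨
        ((g : Matrix (Fin 2) (Fin 2) ℂ) = -1 ∧ (z : ℂ) = -1))

end

/-! Identify the Lie algebra with `ℝ³`, where the bracket is twice the cross product, and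
diagonalise `γ` at the identity against the dot product. Dividing the principal axes `s i` by their
lengths `r i` gives left-invariant orthonormal fields `e i` with `[e_i, e_{i+1}] = μ_{i+2} e_{i+2}`,
where `μ_k` is a common positive multiple of `r_k²`. Everything follows once two of the `r i` agree.

Let `x_i = γ(X, e_i)`. The Ricci coefficients are constant and `γ([e_l, e_i], e_i) = 0`, so the `(i,
i)` component of the equation is a Riccati equation `e_i(x_i) = x_i²/m + a_i` with `a_i` constant.
The integral curves of `e_i` are closed, and a periodic solution of such an equation is stationary
(`riccati_periodic`). Hence `x_i² = -m a_i` on the whole group and `dx_i = 0`. This is where `X`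
loses its freedom: what remains is algebra.

The off-diagonal components now read `x_{i+2} (μ_i - μ_{i+1}) / 2 = x_i x_{i+1} / m`. If the `μ_i`
were distinct, these would force `x = 0`, and the diagonal components would then say that `γ` is
Einstein with three distinct coefficients, which is impossible (`not_injective_of_milnor`).

When two coefficients agree, the Berger form is a rescaling. The form at the identity is then
invariant under rotations about the third axis, so right translations by the circle subgroup with
that axis are isometries and combine with left translations into the action of `SU(2) × U(1)`
(`SU2.isometryGroupContainsSU2U1_of_form`). -/

noncomputable section

/-! ### Connection, Ricci curvature and Lie derivative in an orthonormal frame -/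

section Frames

variable {E : Type*} [NormedAddCommGroup E] [NormedSpace ℝ E]
  {H : Type*} [TopologicalSpace H] {I : ModelWithCorners ℝ E H}
  {M : Type*} [TopologicalSpace M] [ChartedSpace H M] [IsManifold I ∞ M]

/-- The vector field `V` is differentiable at `p`. -/
abbrev FieldDiffAt (V : Π p : M, TangentSpace I p) (p : M) : Prop :=
  MDifferentiableAt I I.tangent (fun q ↦ (⟨q, V q⟩ : TangentBundle I M)) p

lemma IsSmoothField.fieldDiffAt {V : Π p : M, TangentSpace I p} (hV : IsSmoothField V) (p : M) :
    FieldDiffAt V p :=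
  (hV p).mdifferentiableAt (by simp)

lemma SmoothMetric.mdifferentiableAt_pair (γ : SmoothMetric I M)
    {V W : Π p : M, TangentSpace I p} {p : M} (hV : FieldDiffAt V p) (hW : FieldDiffAt W p) :
    MDifferentiableAt I 𝓘(ℝ) (γ.pair V W) p := by
  have hψ := (γ.contMDiff p).mdifferentiableAt (by simp)
  have := MDifferentiableAt.clm_bundle_apply₂ (F₁ := E) (F₂ := E) (F₃ := ℝ)
    (E₃ := Bundle.Trivial M ℝ) (b := id) hψ hV hW
  rw [mdifferentiableAt_totalSpace] at this
  exact this.2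

/-- A global smooth frame which is orthonormal for `γ`. -/
structure IsOrthonormalFrame {ι : Type*} [Fintype ι] [DecidableEq ι] (γ : SmoothMetric I M)
    (e : ι → Π p : M, TangentSpace I p) : Prop where
  smooth : ∀ i, IsSmoothField (e i)
  inner_eq : ∀ i j p, γ.inner p (e i p) (e j p) = if i = j then 1 else 0
  sum_eq : ∀ p (v : TangentSpace I p), ∑ i, γ.inner p v (e i p) • e i p = v

namespace IsOrthonormalFrame

variable {ι : Type*} [Fintype ι] [DecidableEq ι] {γ : SmoothMetric I M}
  {e : ι → Π p : M, TangentSpace I p}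

lemma ext (he : IsOrthonormalFrame γ e) {p : M} {v w : TangentSpace I p}
    (h : ∀ i, γ.inner p v (e i p) = γ.inner p w (e i p)) : v = w := by
  rw [← he.sum_eq p v, ← he.sum_eq p w]
  simp only [h]

lemma inner_sum (he : IsOrthonormalFrame γ e) (p : M) (a : ι → ℝ) (k : ι) :
    γ.inner p (∑ i, a i • e i p) (e k p) = a k := by
  simp [map_sum, he.inner_eq]

lemma pair_eq (he : IsOrthonormalFrame γ e) (i j : ι) :
    γ.pair (e i) (e j) = fun _ ↦ if i = j then 1 else 0 :=
  funext fun p ↦ he.inner_eq i j p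

lemma field_eq (he : IsOrthonormalFrame γ e) (V : Π p : M, TangentSpace I p) :
    V = ∑ i, (γ.pair V (e i)) • e i := by
  funext p
  rw [Finset.sum_apply]
  exact (he.sum_eq p (V p)).symm

lemma basis_exists (he : IsOrthonormalFrame γ e) (p : M) :
    ∃ b : Basis ι ℝ (TangentSpace I p), (∀ i, b i = e i p) ∧
      ∀ v i, b.repr v i = γ.inner p v (e i p) := by
  have hli : LinearIndependent ℝ (fun i ↦ e i p) := by
    rw [Fintype.linearIndependent_iff]
    intro a ha i
    rw [← he.inner_sum p a i, ha]
    simp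
  have hsp : ⊤ ≤ Submodule.span ℝ (Set.range fun i ↦ e i p) := by
    intro v _
    rw [← he.sum_eq p v]
    exact Submodule.sum_mem _ fun i _ ↦
      Submodule.smul_mem _ _ (Submodule.subset_span ⟨i, rfl⟩)
  refine ⟨Basis.mk hli hsp, fun i ↦ by simp, fun v i ↦ ?_⟩
  set b := Basis.mk hli hsp
  conv_rhs => rw [← b.sum_repr v]
  simp only [b, Basis.mk_apply]
  exact (he.inner_sum p _ i).symm

lemma trace_eq (he : IsOrthonormalFrame γ e) (p : M)
    (T : TangentSpace I p →ₗ[ℝ] TangentSpace I p) :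
    LinearMap.trace ℝ (TangentSpace I p) T = ∑ i, γ.inner p (T (e i p)) (e i p) := by
  obtain ⟨b, hb, hr⟩ := he.basis_exists p
  rw [LinearMap.trace_eq_matrix_trace ℝ b, Matrix.trace]
  simp [LinearMap.toMatrix_apply, hb, hr]

lemma fieldDiffAt_sum (he : IsOrthonormalFrame γ e) (a : ι → ℝ) (p : M) :
    FieldDiffAt (∑ k, (fun _ : M ↦ a k) • e k) p := by
  have := MDifferentiableAt.sum_section (F := E) (I := I) (s := Finset.univ)
    (t := fun k ↦ (fun _ : M ↦ a k) • e k) (x₀ := p)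
    fun k _ ↦ MDifferentiableAt.smul_section mdifferentiableAt_const ((he.smooth k).fieldDiffAt p)
  refine this.congr_of_eventuallyEq (Filter.Eventually.of_forall fun q ↦ ?_)
  simp

lemma nabla_sum (nabla : CovariantDerivative I E (TangentSpace I : M → Type _))
    (he : IsOrthonormalFrame γ e) (a : ι → ℝ) (p : M)
    (v : TangentSpace I p) :
    nabla (fun q ↦ ∑ k, a k • e k q) p v = ∑ k, a k • nabla (e k) p v := by
  have key : ∀ s : Finset ι, FieldDiffAt (∑ k ∈ s, a k • e k) p ∧
      nabla (∑ k ∈ s, a k • e k) p = ∑ k ∈ s, a k • nabla (e k) p := by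
    intro s
    induction s using Finset.induction_on with
    | empty =>
      refine ⟨?_, ?_⟩
      · rw [Finset.sum_empty]
        exact mdifferentiableAt_zeroSection ..
      · simp
    | insert i s hi ih =>
      have hd : FieldDiffAt (a i • e i) p :=
        MDifferentiableAt.smul_section (f := fun _ ↦ a i) mdifferentiableAt_const
          ((he.smooth i).fieldDiffAt p)
      rw [Finset.sum_insert hi, Finset.sum_insert hi]
      refine ⟨mdifferentiableAt_add_section hd ih.1, ?_⟩
      rw [← ih.2, ← nabla.isCovariantDerivativeOnUniv.smul_const (a i)
        ((he.smooth i).fieldDiffAt p)]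
      exact nabla.isCovariantDerivativeOnUniv.add hd ih.1
  have h1 : (fun q ↦ ∑ k, a k • e k q) = ∑ k, a k • e k := by
    funext q
    simp
  rw [h1, (key Finset.univ).2]
  simp

end IsOrthonormalFrame

/-- The Christoffel symbols `γ(∇_{e_i} e_j, e_k)` of an orthonormal frame with constant structure
coefficients `γ([e_i, e_j], e_k) = c i j k`, as given by the Koszul formula. -/
def christoffelOf {ι : Type*} (c : ι → ι → ι → ℝ) (i j k : ι) : ℝ :=
  (c i j k - c j k i + c k i j) / 2

/-- The Ricci curvature `Ric(e_j, e_k)` in an orthonormal frame with constant structure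
coefficients. -/
def ricciOf {ι : Type*} [Fintype ι] (c : ι → ι → ι → ℝ) (j k : ι) : ℝ :=
  ∑ i, ∑ l, (christoffelOf c j k l * christoffelOf c i l i
    - christoffelOf c i k l * christoffelOf c j l i - c i j l * christoffelOf c l k i)

variable [FiniteDimensional ℝ E] {ι : Type*} [Fintype ι] [DecidableEq ι] {γ : SmoothMetric I M}
  {e : ι → Π p : M, TangentSpace I p} {c : ι → ι → ι → ℝ}
  {nabla : CovariantDerivative I E (TangentSpace I : M → Type _)}

lemma IsLeviCivita.sub_eq_mlieBracket (h : IsLeviCivita γ nabla)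
    {V W : Π p : M, TangentSpace I p} {p : M} (hV : FieldDiffAt V p) (hW : FieldDiffAt W p) :
    nabla W p (V p) - nabla V p (W p) = VectorField.mlieBracket I V W p :=
  nabla.torsion_eq_zero_iff.1 h.torsion_free hV hW

/-- Koszul's argument: the products `γ(e_j, e_k)` are constant, so metric compatibility is
skew-symmetry in `j, k`. Three cyclic instances of it and three of torsion-freeness determine the
symbol. -/
lemma IsLeviCivita.inner_eq_christoffelOf (h : IsLeviCivita γ nabla)
    (he : IsOrthonormalFrame γ e)
    (hc : ∀ i j p, VectorField.mlieBracket I (e i) (e j) p = ∑ k, c i j k • e k p)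
    (i j k : ι) (p : M) :
    γ.inner p (nabla (e j) p (e i p)) (e k p) = christoffelOf c i j k := by
  have hm : ∀ i j k, γ.inner p (nabla (e j) p (e i p)) (e k p)
      + γ.inner p (nabla (e k) p (e i p)) (e j p) = 0 := by
    intro i j k
    have := h.metric (e j) (e k) p ((he.smooth j).fieldDiffAt p) ((he.smooth k).fieldDiffAt p)
      (e i p)
    rw [he.pair_eq, mvfderiv_const, γ.symm p (e j p)] at this
    simpa using this.symm
  have ht : ∀ i j k, γ.inner p (nabla (e j) p (e i p)) (e k p)
      - γ.inner p (nabla (e i) p (e j p)) (e k p) = c i j k := by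
    intro i j k
    have := h.sub_eq_mlieBracket ((he.smooth i).fieldDiffAt p) ((he.smooth j).fieldDiffAt p)
    rw [hc] at this
    rw [← he.inner_sum p (c i j) k, ← this]
    simp
  unfold christoffelOf
  linarith [ht i j k, ht j k i, ht k i j, hm i j k, hm j k i, hm k i j]

lemma IsLeviCivita.frame_eq (h : IsLeviCivita γ nabla) (he : IsOrthonormalFrame γ e)
    (hc : ∀ i j p, VectorField.mlieBracket I (e i) (e j) p = ∑ k, c i j k • e k p)
    (i j : ι) (p : M) :
    nabla (e j) p (e i p) = ∑ k, christoffelOf c i j k • e k p :=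
  he.ext fun k ↦ by rw [h.inner_eq_christoffelOf he hc, he.inner_sum]

lemma IsLeviCivita.apply_field_eq (h : IsLeviCivita γ nabla) (he : IsOrthonormalFrame γ e)
    (hc : ∀ i j p, VectorField.mlieBracket I (e i) (e j) p = ∑ k, c i j k • e k p)
    (V : Π p : M, TangentSpace I p) (j : ι) :
    (fun q ↦ nabla (e j) q (V q))
      = ∑ i, γ.pair V (e i) • ∑ k, (fun _ : M ↦ christoffelOf c i j k) • e k := by
  funext q
  conv_lhs => rw [← he.sum_eq q (V q), map_sum]
  rw [Finset.sum_apply]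
  refine Finset.sum_congr rfl fun i _ ↦ ?_
  rw [map_smul, h.frame_eq he hc, Pi.smul_apply', Finset.sum_apply]
  rfl

/-- The explicit Christoffel coefficients supply the regularity of `∇_V e_j` that is needed to
differentiate it again in the curvature. -/
lemma IsLeviCivita.fieldDiffAt_apply (h : IsLeviCivita γ nabla) (he : IsOrthonormalFrame γ e)
    (hc : ∀ i j p, VectorField.mlieBracket I (e i) (e j) p = ∑ k, c i j k • e k p)
    {V : Π p : M, TangentSpace I p} {p : M} (hV : FieldDiffAt V p) (j : ι) :
    FieldDiffAt (fun q ↦ nabla (e j) q (V q)) p := by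
  rw [h.apply_field_eq he hc V j]
  have := MDifferentiableAt.sum_section (F := E) (I := I) (s := Finset.univ)
    (t := fun i ↦ γ.pair V (e i) • ∑ k, (fun _ : M ↦ christoffelOf c i j k) • e k) (x₀ := p)
    fun i _ ↦ MDifferentiableAt.smul_section
      (γ.mdifferentiableAt_pair hV ((he.smooth i).fieldDiffAt p)) (he.fieldDiffAt_sum _ p)
  refine this.congr_of_eventuallyEq (Filter.Eventually.of_forall fun q ↦ ?_)
  simp

/-- The map `U ↦ R(U, e_j) e_k` depends only on the value of `U` at the point. -/
lemma IsLeviCivita.tensorialAt_curvature (h : IsLeviCivita γ nabla)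
    (he : IsOrthonormalFrame γ e)
    (hc : ∀ i j p, VectorField.mlieBracket I (e i) (e j) p = ∑ k, c i j k • e k p)
    (j k : ι) (p : M) :
    TensorialAt I E (fun U ↦ curvatureAt nabla U (e j) (e k) p) p where
  smul {f U} hf hU := by
    have h1 : (fun q ↦ nabla (e k) q ((f • U) q)) = f • fun q ↦ nabla (e k) q (U q) := by
      funext q
      simp
    have h2 := nabla.isCovariantDerivativeOnUniv.leibniz (h.fieldDiffAt_apply he hc hU k) hf
    have h3 := congrArg (fun T ↦ T (e j p)) h2
    simp only [_root_.add_apply, _root_.smul_apply,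
      ContinuousLinearMap.smulRight_apply] at h3
    -- The Leibniz term `e_j(f) • ∇_U e_k` cancels against the one produced by `[f • U, e_j]`.
    simp only [curvatureAt]
    rw [h1, h3, VectorField.mlieBracket_smul_left hf hU, Pi.smul_apply', map_smul, map_add,
      map_smul, map_smul]
    module
  add {U U'} hU hU' := by
    have h1 : (fun q ↦ nabla (e k) q ((U + U') q))
        = (fun q ↦ nabla (e k) q (U q)) + fun q ↦ nabla (e k) q (U' q) := by
      funext q
      simp
    have h2 := nabla.isCovariantDerivativeOnUniv.add (h.fieldDiffAt_apply he hc hU k)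
      (h.fieldDiffAt_apply he hc hU' k)
    have h3 := congrArg (fun T ↦ T (e j p)) h2
    simp only [_root_.add_apply] at h3
    simp only [curvatureAt]
    rw [h1, h3, VectorField.mlieBracket_add_left hU hU', Pi.add_apply, map_add, map_add]
    module

lemma IsLeviCivita.curvatureAt_frame (h : IsLeviCivita γ nabla) (he : IsOrthonormalFrame γ e)
    (hc : ∀ i j p, VectorField.mlieBracket I (e i) (e j) p = ∑ k, c i j k • e k p)
    (i j k n : ι) (p : M) :
    γ.inner p (curvatureAt nabla (e i) (e j) (e k) p) (e n p)
      = ∑ l, (christoffelOf c j k l * christoffelOf c i l n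
          - christoffelOf c i k l * christoffelOf c j l n - c i j l * christoffelOf c l k n) := by
  simp only [curvatureAt, h.frame_eq he hc, he.nabla_sum nabla, hc, map_sub, map_sum,
    map_smul, _root_.sub_apply, _root_.sum_apply,
    _root_.smul_apply, he.inner_eq]
  simp [Finset.sum_sub_distrib]

/-- Tensoriality turns the endomorphism in `ricciAt`, given by an arbitrary basis and arbitrary
extensions, into one linear map `T`, whose trace may be taken in the frame. -/
lemma IsLeviCivita.ricciAt_frame (h : IsLeviCivita γ nabla) (he : IsOrthonormalFrame γ e)
    (hc : ∀ i j p, VectorField.mlieBracket I (e i) (e j) p = ∑ k, c i j k • e k p)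
    (j k : ι) (p : M) : ricciAt nabla (e j) (e k) p = ricciOf c j k := by
  have ht := h.tensorialAt_curvature he hc j k p
  set T := TensorialAt.mkHom _ p ht
  let b : Basis (Fin (finrank ℝ E)) ℝ (TangentSpace I p) := finBasis ℝ E
  have hT : (b.constr ℝ fun i ↦ curvatureAt nabla (FiberBundle.extend E (b i)) (e j) (e k) p)
      = (T : TangentSpace I p →ₗ[ℝ] TangentSpace I p) := by
    refine b.ext fun i ↦ ?_
    rw [Basis.constr_basis]
    rfl
  refine (congrArg (LinearMap.trace ℝ (TangentSpace I p)) hT).trans ?_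
  rw [he.trace_eq, ricciOf]
  refine Finset.sum_congr rfl fun i _ ↦ ?_
  rw [ContinuousLinearMap.coe_coe, TensorialAt.mkHom_apply ht ((he.smooth i).fieldDiffAt p),
    h.curvatureAt_frame he hc]

/-- The Lie derivative of the metric in an orthonormal frame with constant structure
coefficients. -/
lemma IsOrthonormalFrame.lieDerivMetricAt_frame (he : IsOrthonormalFrame γ e)
    (hc : ∀ i j p, VectorField.mlieBracket I (e i) (e j) p = ∑ k, c i j k • e k p)
    {X : Π p : M, TangentSpace I p} {p : M} (hX : FieldDiffAt X p) (i j : ι) :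
    lieDerivMetricAt γ X (e i) (e j) p
      = mvfderiv I (γ.pair X (e j)) p (e i p) + mvfderiv I (γ.pair X (e i)) p (e j p)
        - ∑ l, γ.pair X (e l) p * (c l i j + c l j i) := by
  have hd : ∀ l, MDifferentiableAt I 𝓘(ℝ) (γ.pair X (e l)) p := fun l ↦
    γ.mdifferentiableAt_pair hX ((he.smooth l).fieldDiffAt p)
  -- Expand `X = ∑ x_l e_l` and bracket term by term; the induction carries differentiability of the
  -- partial sums along.
  have key : ∀ (k : ι) (s : Finset ι), FieldDiffAt (∑ l ∈ s, γ.pair X (e l) • e l) p ∧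
      VectorField.mlieBracket I (∑ l ∈ s, γ.pair X (e l) • e l) (e k) p
        = ∑ l ∈ s, (-(mvfderiv I (γ.pair X (e l)) p (e k p)) • e l p
            + γ.pair X (e l) p • ∑ n, c l k n • e n p) := by
    intro k s
    induction s using Finset.induction_on with
    | empty =>
      refine ⟨?_, ?_⟩
      · rw [Finset.sum_empty]
        exact mdifferentiableAt_zeroSection ..
      · simp
    | insert l s hl ih =>
      have hs : FieldDiffAt (γ.pair X (e l) • e l) p :=
        MDifferentiableAt.smul_section (hd l) ((he.smooth l).fieldDiffAt p)
      rw [Finset.sum_insert hl, Finset.sum_insert hl]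
      refine ⟨mdifferentiableAt_add_section hs ih.1, ?_⟩
      rw [VectorField.mlieBracket_add_left hs ih.1, ih.2,
        VectorField.mlieBracket_smul_left (hd l) ((he.smooth l).fieldDiffAt p), hc]
  have hb : ∀ k n, γ.inner p (VectorField.mlieBracket I X (e k) p) (e n p)
      = -(mvfderiv I (γ.pair X (e n)) p (e k p)) + ∑ l, γ.pair X (e l) p * c l k n := by
    intro k n
    conv_lhs => rw [he.field_eq X, (key k Finset.univ).2]
    simp [Finset.sum_add_distrib, he.inner_eq]
  rw [lieDerivMetricAt, he.pair_eq, mvfderiv_const, γ.symm p (e i p), hb, hb]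
  simp only [mul_add, Finset.sum_add_distrib, _root_.zero_apply]
  ring

end Frames

/-! ### Brackets of vector fields as commutators of derivations -/

section Commutator

variable {E : Type*} [NormedAddCommGroup E] [NormedSpace ℝ E] [CompleteSpace E]
  {H : Type*} [TopologicalSpace H] {I : ModelWithCorners ℝ E H}
  {M : Type*} [TopologicalSpace M] [ChartedSpace H M] [IsManifold I ∞ M]

lemma two_le_infty : minSmoothness ℝ 2 ≤ (∞ : ℕ∞ω) := by
  rw [minSmoothness_of_isRCLikeNormedField]
  exact WithTop.coe_le_coe.2 (le_top : (2 : ℕ∞) ≤ ⊤)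

lemma three_le_infty : minSmoothness ℝ 3 ≤ (∞ : ℕ∞ω) := by
  rw [minSmoothness_of_isRCLikeNormedField]
  exact WithTop.coe_le_coe.2 (le_top : (3 : ℕ∞) ≤ ⊤)

lemma IsSmoothField.mlieBracket {V W : Π p : M, TangentSpace I p}
    (hV : IsSmoothField V) (hW : IsSmoothField W) :
    IsSmoothField (VectorField.mlieBracket I V W) := by
  have : IsManifold I ((⊤ : ℕ∞) + 1 : ℕ∞ω) M := inferInstanceAs (IsManifold I ∞ M)
  have : IsManifold I (minSmoothness ℝ 2) M := IsManifold.of_le (n := ∞) two_le_infty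
  have : IsManifold I (minSmoothness ℝ 3) M := IsManifold.of_le (n := ∞) three_le_infty
  exact ContDiff.mlieBracket_vectorField (m := ⊤) (n := ⊤) hV hW (by simp)

/-- The Lie bracket of vector fields acts on functions as a commutator, at every point at which
some smooth vector field does not vanish. -/
lemma mvfderiv_mlieBracket {U V W : Π p : M, TangentSpace I p} (hU : IsSmoothField U)
    (hV : IsSmoothField V) (hW : IsSmoothField W) {p : M} (hp : W p ≠ 0) {f : M → ℝ}
    (hf : ContMDiff I 𝓘(ℝ) ∞ f)
    (hUf : MDifferentiableAt I 𝓘(ℝ) (fun q ↦ mvfderiv I f q (U q)) p)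
    (hVf : MDifferentiableAt I 𝓘(ℝ) (fun q ↦ mvfderiv I f q (V q)) p) :
    mvfderiv I f p (VectorField.mlieBracket I U V p)
      = mvfderiv I (fun q ↦ mvfderiv I f q (V q)) p (U p)
        - mvfderiv I (fun q ↦ mvfderiv I f q (U q)) p (V p) := by
  have hfd : ∀ q, MDifferentiableAt I 𝓘(ℝ) f q := fun q ↦ (hf q).mdifferentiableAt (by simp)
  have hb : ∀ T : Π p : M, TangentSpace I p, VectorField.mlieBracket I T (f • W)
      = (fun q ↦ mvfderiv I f q (T q)) • W + f • VectorField.mlieBracket I T W := fun T ↦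
    funext fun q ↦ VectorField.mlieBracket_smul_right (hfd q) (hW.fieldDiffAt q)
  have hdd : ∀ S T : Π p : M, TangentSpace I p, IsSmoothField T →
      MDifferentiableAt I 𝓘(ℝ) (fun q ↦ mvfderiv I f q (T q)) p →
      VectorField.mlieBracket I S (VectorField.mlieBracket I T (f • W)) p
        = mvfderiv I (fun q ↦ mvfderiv I f q (T q)) p (S p) • W p
          + mvfderiv I f p (T p) • VectorField.mlieBracket I S W p
          + (mvfderiv I f p (S p) • VectorField.mlieBracket I T W p
            + f p • VectorField.mlieBracket I S (VectorField.mlieBracket I T W) p) := by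
    intro S T hT hTf
    have h1 := (hT.mlieBracket hW).fieldDiffAt p
    have h2 := hW.fieldDiffAt p
    rw [hb T, VectorField.mlieBracket_add_right (MDifferentiableAt.smul_section hTf h2)
      (MDifferentiableAt.smul_section (hfd p) h1),
      VectorField.mlieBracket_smul_right hTf h2, VectorField.mlieBracket_smul_right (hfd p) h1]
  have : IsManifold I (minSmoothness ℝ 3) M := IsManifold.of_le (n := ∞) three_le_infty
  have hle := two_le_infty
  -- Take the Jacobi identity for `U, V, f • W` and subtract `f` times the one for `U, V, W`. The
  -- mixed terms cancel and leave `([U,V]f - UVf + VUf) • W = 0`.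
  have hj := VectorField.leibniz_identity_mlieBracket_apply ((hU p).of_le hle) ((hV p).of_le hle)
    (((hf p).smul_section (hW p)).of_le hle)
  have hj' := VectorField.leibniz_identity_mlieBracket_apply ((hU p).of_le hle)
    ((hV p).of_le hle) ((hW p).of_le hle)
  rw [hdd U V hV hVf, hdd V U hU hUf, hj', congrFun (hb (VectorField.mlieBracket I U V)) p] at hj
  have h0 : (mvfderiv I f p (VectorField.mlieBracket I U V p)
      - (mvfderiv I (fun q ↦ mvfderiv I f q (V q)) p (U p)
        - mvfderiv I (fun q ↦ mvfderiv I f q (U q)) p (V p))) • W p = 0 := by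
    simp only [Pi.add_apply, Pi.smul_apply'] at hj
    rw [← sub_eq_zero] at hj
    rw [← neg_eq_zero, ← hj]
    module
  exact sub_eq_zero.1 ((smul_eq_zero.1 h0).resolve_right hp)

end Commutator

/-! ### Smoothness of left-invariant fields -/

section LieGroup

variable {E : Type*} [NormedAddCommGroup E] [NormedSpace ℝ E]
  {H : Type*} [TopologicalSpace H] {I : ModelWithCorners ℝ E H}
  {G : Type*} [TopologicalSpace G] [ChartedSpace H G] [Group G] [LieGroup I ∞ G]

/-- The field is the tangent map of multiplication composed with the smooth map `g ↦ (0_g, v)`. -/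
lemma isSmoothField_mulInvariantVectorField (v : GroupLieAlgebra I G) :
    IsSmoothField (mulInvariantVectorField v) := by
  let fg : G → TangentBundle I G := fun g ↦ TotalSpace.mk' E g 0
  have sfg : ContMDiff I I.tangent ∞ fg := contMDiff_zeroSection _ _
  let fv : G → TangentBundle I G := fun _ ↦ TotalSpace.mk' E 1 v
  have sfv : ContMDiff I I.tangent ∞ fv := contMDiff_const
  let F₁ : G → (TangentBundle I G × TangentBundle I G) := fun g ↦ (fg g, fv g)
  have S₁ : ContMDiff I (I.tangent.prod I.tangent) ∞ F₁ := sfg.prodMk sfv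
  let F₂ : (TangentBundle I G × TangentBundle I G) → TangentBundle (I.prod I) (G × G) :=
    (equivTangentBundleProd I G I G).symm
  have S₂ : ContMDiff (I.tangent.prod I.tangent) (I.prod I).tangent ∞ F₂ :=
    contMDiff_equivTangentBundleProd_symm
  let F₃ : TangentBundle (I.prod I) (G × G) → TangentBundle I G :=
    tangentMap (I.prod I) I (fun p : G × G ↦ p.1 * p.2)
  have S₃ : ContMDiff (I.prod I).tangent I.tangent ∞ F₃ :=
    ContMDiff.contMDiff_tangentMap (contMDiff_mul I ∞) (m := ∞) (by simp)
  have S := (S₃.comp S₂).comp S₁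
  unfold IsSmoothField
  convert! S with g
  · simp [F₁, F₂, F₃, fg, fv]
  · simp only [Function.comp_apply, tangentMap, F₃, F₂, F₁, fg, fv]
    rw [mfderiv_prod_eq_add_apply ((contMDiff_mul I ∞).mdifferentiableAt (by simp))]
    change mfderiv I I (fun x ↦ g * x) 1 v
      = mfderiv I I (fun z ↦ z * (1 : G)) g 0 + mfderiv I I (fun z ↦ g * z) 1 v
    rw [map_zero, zero_add]

end LieGroup

/-! ### `SU(2)` as the unit quaternions: left-invariant fields and circle subgroups -/

namespace SU2

lemma lieGroup_infty : LieGroup (𝓡 3) ∞ SU2 := LieGroup.of_le (n := ω) le_top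

attribute [local instance] lieGroup_infty

/-- The product of two matrices of the form `mat v`, in terms of their first columns. -/
def quatMul : EuclideanSpace ℝ (Fin (3 + 1)) →ₗ[ℝ] EuclideanSpace ℝ (Fin (3 + 1)) →ₗ[ℝ]
    EuclideanSpace ℝ (Fin (3 + 1)) :=
  LinearMap.mk₂ ℝ (fun v w ↦ !₂[v 0 * w 0 - v 1 * w 1 - v 2 * w 2 - v 3 * w 3,
      v 0 * w 1 + v 1 * w 0 - v 2 * w 3 + v 3 * w 2,
      v 2 * w 0 - v 3 * w 1 + v 0 * w 2 + v 1 * w 3,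
      v 2 * w 1 + v 3 * w 0 + v 0 * w 3 - v 1 * w 2])
    (fun _ _ _ ↦ by ext i; fin_cases i <;> simp <;> ring)
    (fun _ _ _ ↦ by ext i; fin_cases i <;> simp <;> ring)
    (fun _ _ _ ↦ by ext i; fin_cases i <;> simp <;> ring)
    (fun _ _ _ ↦ by ext i; fin_cases i <;> simp <;> ring)

lemma quatMul_apply (v w : EuclideanSpace ℝ (Fin (3 + 1))) :
    quatMul v w = !₂[v 0 * w 0 - v 1 * w 1 - v 2 * w 2 - v 3 * w 3,
      v 0 * w 1 + v 1 * w 0 - v 2 * w 3 + v 3 * w 2,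
      v 2 * w 0 - v 3 * w 1 + v 0 * w 2 + v 1 * w 3,
      v 2 * w 1 + v 3 * w 0 + v 0 * w 3 - v 1 * w 2] := rfl

lemma quatMul_assoc (u v w : EuclideanSpace ℝ (Fin (3 + 1))) :
    quatMul (quatMul u v) w = quatMul u (quatMul v w) := by
  ext i
  fin_cases i <;> simp [quatMul_apply] <;> ring

lemma col_mat_mul (v w : EuclideanSpace ℝ (Fin (3 + 1))) :
    col (mat v * mat w) = quatMul v w := by
  ext i
  fin_cases i <;> simp [quatMul_apply, col, mat, Matrix.mul_apply, Fin.sum_univ_two] <;> ring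

lemma col_mul (A B : SU2) : col (A * B).1 = quatMul (col A.1) (col B.1) := by
  rw [← col_mat_mul, mat_col, mat_col]
  rfl

lemma col_injective : Function.Injective (fun A : SU2 ↦ col A.1) := fun A B h ↦
  Subtype.ext ((mat_col A).symm.trans ((congrArg mat h).trans (mat_col B)))

lemma col_one : col (1 : SU2).1 = !₂[1, 0, 0, 0] := by
  ext i
  fin_cases i <;> simp [col]

/-- The differential of the embedding of `SU(2)` in `ℝ⁴`. -/
def dcol (g : SU2) : TangentSpace (𝓡 3) g →L[ℝ] EuclideanSpace ℝ (Fin (3 + 1)) :=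
  mvfderiv (𝓡 3) (fun A : SU2 ↦ col A.1) g

lemma mdifferentiableAt_col (g : SU2) :
    MDifferentiableAt (𝓡 3) 𝓘(ℝ, EuclideanSpace ℝ (Fin (3 + 1))) (fun A : SU2 ↦ col A.1) g :=
  (contMDiff_col (n := ∞) g).mdifferentiableAt (by simp)

/-- The embedding is a diffeomorphism onto the sphere followed by an immersion. Identities between
tangent vectors can therefore be checked in `ℝ⁴`, where multiplication is bilinear. -/
lemma dcol_injective (g : SU2) : Function.Injective (dcol g) := by
  have := Fact.mk (@finrank_euclideanSpace_fin ℝ _ (3 + 1))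
  have h1 : MDifferentiableAt (𝓡 3) (𝓡 3) homeo g :=
    (contMDiff_homeo (n := ∞) g).mdifferentiableAt (by simp)
  have h2 : MDifferentiableAt (𝓡 3) (𝓡 3) homeo.symm (homeo g) :=
    (contMDiff_homeo_symm (n := ∞) _).mdifferentiableAt (by simp)
  have h3 : MDifferentiableAt (𝓡 3) 𝓘(ℝ, EuclideanSpace ℝ (Fin (3 + 1)))
      ((↑) : S3 → EuclideanSpace ℝ (Fin (3 + 1))) (homeo g) :=
    ((contMDiff_coe_sphere (m := ∞)) _).mdifferentiableAt (by simp)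
  have hinj : Function.Injective (mfderiv (𝓡 3) (𝓡 3) homeo g) := by
    have h := mfderiv_comp g h2 h1
    rw [show (homeo.symm ∘ homeo : SU2 → SU2) = id from funext homeo.symm_apply_apply,
      mfderiv_id] at h
    refine Function.LeftInverse.injective (g := mfderiv (𝓡 3) (𝓡 3) homeo.symm (homeo g))
      fun v ↦ ?_
    exact (DFunLike.congr_fun h v).symm
  have h := mfderiv_comp g h3 h1
  intro v w hvw
  refine hinj (injective_mvfderiv_subtypeVal_sphere (homeo g) ?_)
  have hv := DFunLike.congr_fun h v
  have hw := DFunLike.congr_fun h w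
  exact (hv.symm.trans hvw).trans hw

/-- In `ℝ⁴` left translation is the restriction of a linear map, which is its own derivative. -/
lemma dcol_mfderiv_mul_left (g h : SU2) (v : TangentSpace (𝓡 3) h) :
    dcol (g * h) (mfderiv (𝓡 3) (𝓡 3) (fun x ↦ g * x) h v) = quatMul (col g.1) (dcol h v) := by
  have h1 : MDifferentiableAt (𝓡 3) (𝓡 3) (fun x : SU2 ↦ g * x) h :=
    (contMDiff_mul_left (I := 𝓡 3) (n := ∞) h).mdifferentiableAt (by simp)
  have h2 := mfderiv_comp h (mdifferentiableAt_col (g * h)) h1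
  have h3 := mfderiv_comp h (I' := 𝓘(ℝ, EuclideanSpace ℝ (Fin (3 + 1))))
    ((quatMul (col g.1)).toContinuousLinearMap.mdifferentiableAt) (mdifferentiableAt_col h)
  have h4 : (fun A : SU2 ↦ col A.1) ∘ (fun x ↦ g * x)
      = (quatMul (col g.1)).toContinuousLinearMap ∘ fun A : SU2 ↦ col A.1 :=
    funext fun x ↦ col_mul g x
  rw [h4, h3, ContinuousLinearMap.mfderiv_eq] at h2
  exact (DFunLike.congr_fun h2 v).symm

lemma dcol_mfderiv_mul_right (g h : SU2) (v : TangentSpace (𝓡 3) g) :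
    dcol (g * h) (mfderiv (𝓡 3) (𝓡 3) (fun x ↦ x * h) g v) = quatMul (dcol g v) (col h.1) := by
  have h1 : MDifferentiableAt (𝓡 3) (𝓡 3) (fun x : SU2 ↦ x * h) g :=
    (contMDiff_mul_right (I := 𝓡 3) (n := ∞) g).mdifferentiableAt (by simp)
  have h2 := mfderiv_comp g (mdifferentiableAt_col (g * h)) h1
  have h3 := mfderiv_comp g (I' := 𝓘(ℝ, EuclideanSpace ℝ (Fin (3 + 1))))
    ((quatMul.flip (col h.1)).toContinuousLinearMap.mdifferentiableAt) (mdifferentiableAt_col g)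
  have h4 : (fun A : SU2 ↦ col A.1) ∘ (fun x ↦ x * h)
      = (quatMul.flip (col h.1)).toContinuousLinearMap ∘ fun A : SU2 ↦ col A.1 :=
    funext fun x ↦ col_mul x h
  rw [h4, h3, ContinuousLinearMap.mfderiv_eq] at h2
  exact (DFunLike.congr_fun h2 v).symm

lemma dcol_mulInvariantVectorField (v : GroupLieAlgebra (𝓡 3) SU2) (g : SU2) :
    dcol g (mulInvariantVectorField v g) = quatMul (col g.1) (dcol 1 v) := by
  have h := dcol_mfderiv_mul_left g 1 v
  -- The points `g * 1` and `g` are only propositionally equal, but all tangent spaces are the same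
  -- model space.
  have transport : ∀ (q : SU2) (_ : q = g) (w : EuclideanSpace ℝ (Fin 3)),
      dcol q (w : TangentSpace (𝓡 3) q) = dcol g (w : TangentSpace (𝓡 3) g) := by
    rintro q rfl w
    rfl
  exact (transport (g * 1) (mul_one g) _).symm.trans h

/-- The imaginary quaternion `-a`. -/
def imag : (Fin 3 → ℝ) →ₗ[ℝ] EuclideanSpace ℝ (Fin (3 + 1)) where
  toFun a := !₂[0, -a 0, -a 1, -a 2]
  map_add' _ _ := by ext i; fin_cases i <;> simp <;> ring
  map_smul' _ _ := by ext i; fin_cases i <;> simp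

lemma imag_apply (a : Fin 3 → ℝ) : imag a = !₂[0, -a 0, -a 1, -a 2] := rfl

lemma imag_injective : Function.Injective imag := by
  intro a b h
  funext i
  have h1 := congrFun (congrArg (WithLp.ofLp) h)
  fin_cases i
  · simpa [imag_apply] using h1 1
  · simpa [imag_apply] using h1 2
  · simpa [imag_apply] using h1 3

/-- With the coordinates of `col`, the first two imaginary units multiply to minus the third. The
sign in `imag` compensates, so that the commutator is `+2` times the cross product. -/
lemma quatMul_imag_sub (a b : Fin 3 → ℝ) :
    quatMul (imag a) (imag b) - quatMul (imag b) (imag a) = imag ((2 : ℝ) • (a ⨯₃ b)) := by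
  ext i
  fin_cases i <;> simp [quatMul_apply, imag_apply, cross_apply] <;> ring

/-- The unit quaternion `x - y a`. -/
def rotor (a : Fin 3 → ℝ) (x y : ℝ) : EuclideanSpace ℝ (Fin (3 + 1)) :=
  !₂[x, -(y * a 0), -(y * a 1), -(y * a 2)]

lemma rotor_eq (a : Fin 3 → ℝ) (x y : ℝ) :
    rotor a x y = x • !₂[1, 0, 0, 0] + y • imag a := by
  ext i
  fin_cases i <;> simp [rotor, imag_apply]

lemma rotor_sq {a : Fin 3 → ℝ} (ha : a ⬝ᵥ a = 1) {x y : ℝ} (hxy : x ^ 2 + y ^ 2 = 1) :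
    rotor a x y 0 ^ 2 + rotor a x y 1 ^ 2 + rotor a x y 2 ^ 2 + rotor a x y 3 ^ 2 = 1 := by
  simp only [dotProduct, Fin.sum_univ_three] at ha
  simp only [rotor, PiLp.toLp_apply]
  simp
  linear_combination y ^ 2 * ha + hxy

/-- The element `x - y a` of `SU(2)`, for a unit vector `a` and `x ^ 2 + y ^ 2 = 1`. -/
def rot {a : Fin 3 → ℝ} (ha : a ⬝ᵥ a = 1) (x y : ℝ) (hxy : x ^ 2 + y ^ 2 = 1) : SU2 :=
  ⟨mat (rotor a x y), mat_mem (rotor_sq ha hxy)⟩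

lemma col_rot {a : Fin 3 → ℝ} (ha : a ⬝ᵥ a = 1) (x y : ℝ) (hxy : x ^ 2 + y ^ 2 = 1) :
    col (rot ha x y hxy).1 = rotor a x y := col_mat _

/-- The one-parameter subgroup of `SU(2)` with axis `a`. -/
def circleCurve {a : Fin 3 → ℝ} (ha : a ⬝ᵥ a = 1) (t : ℝ) : SU2 :=
  rot ha (Real.cos t) (Real.sin t) (Real.cos_sq_add_sin_sq t)

lemma circleCurve_zero {a : Fin 3 → ℝ} (ha : a ⬝ᵥ a = 1) : circleCurve ha 0 = 1 := by
  refine col_injective ?_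
  simp only [circleCurve, col_rot, col_one]
  simp [rotor]

lemma circleCurve_periodic {a : Fin 3 → ℝ} (ha : a ⬝ᵥ a = 1) :
    Function.Periodic (circleCurve ha) (2 * Real.pi) := by
  intro t
  simp [circleCurve]

lemma hasDerivAt_rotor (a : Fin 3 → ℝ) (t : ℝ) :
    HasDerivAt (fun t ↦ rotor a (Real.cos t) (Real.sin t))
      (rotor a (-Real.sin t) (Real.cos t)) t := by
  simp only [rotor_eq]
  exact ((Real.hasDerivAt_cos t).smul_const _).add ((Real.hasDerivAt_sin t).smul_const _)

lemma contMDiff_circleCurve {a : Fin 3 → ℝ} (ha : a ⬝ᵥ a = 1) :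
    ContMDiff 𝓘(ℝ) (𝓡 3) ∞ (circleCurve ha) := by
  apply contMDiff_of_col
  simp only [circleCurve, col_rot]
  rw [contMDiff_iff_contDiff, contDiff_euclidean]
  intro i
  fin_cases i <;> simp [rotor] <;> fun_prop

/-- For a unit vector, `imag a` squares to `-1`, so `cos t + sin t • imag a` is its exponential and
the velocity is left-invariant. -/
lemma dcol_mfderiv_circleCurve {a : Fin 3 → ℝ} (ha : a ⬝ᵥ a = 1) (t : ℝ) :
    dcol (circleCurve ha t) (mfderiv 𝓘(ℝ) (𝓡 3) (circleCurve ha) t (1 : ℝ))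
      = quatMul (col (circleCurve ha t).1) (imag a) := by
  have h1 : MDifferentiableAt 𝓘(ℝ) (𝓡 3) (circleCurve ha) t :=
    (contMDiff_circleCurve ha t).mdifferentiableAt (by simp)
  have h2 := mfderiv_comp t (mdifferentiableAt_col (circleCurve ha t)) h1
  have h4 : (fun A : SU2 ↦ col A.1) ∘ circleCurve ha
      = fun t ↦ rotor a (Real.cos t) (Real.sin t) := funext fun t ↦ col_rot ha _ _ _
  rw [h4, mfderiv_eq_fderiv, (hasDerivAt_rotor a t).hasFDerivAt.fderiv] at h2
  have h5 : dcol (circleCurve ha t) (mfderiv 𝓘(ℝ) (𝓡 3) (circleCurve ha) t (1 : ℝ))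
      = rotor a (-Real.sin t) (Real.cos t) := by
    refine (DFunLike.congr_fun h2 (1 : ℝ)).symm.trans ?_
    exact one_smul ℝ (rotor a (-Real.sin t) (Real.cos t))
  rw [h5, circleCurve, col_rot]
  simp only [dotProduct, Fin.sum_univ_three] at ha
  ext i
  fin_cases i <;> simp [quatMul_apply, imag_apply, rotor]
  · linear_combination Real.sin t * ha
  all_goals ring

/-- The velocities at the identity of the three coordinate circles form such a basis. -/
lemma exists_algebraBasis : ∃ b : Basis (Fin 3) ℝ (GroupLieAlgebra (𝓡 3) SU2),
    ∀ i, dcol 1 (b i) = imag (Pi.single i 1) := by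
  have ha : ∀ i : Fin 3, (Pi.single i 1 : Fin 3 → ℝ) ⬝ᵥ Pi.single i 1 = 1 := by simp
  have transport : ∀ (q : SU2) (_ : q = 1) (w : EuclideanSpace ℝ (Fin 3)),
      dcol q (w : TangentSpace (𝓡 3) q) = dcol 1 (w : TangentSpace (𝓡 3) (1 : SU2)) := by
    rintro q rfl w
    rfl
  let v : Fin 3 → GroupLieAlgebra (𝓡 3) SU2 := fun i ↦
    (mfderiv 𝓘(ℝ) (𝓡 3) (circleCurve (ha i)) 0 (1 : ℝ) : EuclideanSpace ℝ (Fin 3))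
  have hv : ∀ i, dcol 1 (v i) = imag (Pi.single i 1) := by
    intro i
    refine (transport _ (circleCurve_zero (ha i)) _).symm.trans ?_
    rw [dcol_mfderiv_circleCurve, circleCurve_zero, col_one]
    ext k
    fin_cases k <;> simp [quatMul_apply]
  have hli : LinearIndependent ℝ v := by
    refine LinearIndependent.of_comp (dcol (1 : SU2)).toLinearMap ?_
    have h := ((Pi.basisFun ℝ (Fin 3)).linearIndependent).map' imag
      (LinearMap.ker_eq_bot.2 imag_injective)
    rw [show (dcol (1 : SU2)).toLinearMap ∘ v = imag ∘ Pi.basisFun ℝ (Fin 3) from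
      funext fun i ↦ by simp [hv]]
    exact h
  have hfin : Fintype.card (Fin 3) = finrank ℝ (GroupLieAlgebra (𝓡 3) SU2) :=
    (finrank_euclideanSpace_fin (𝕜 := ℝ) (n := 3)).symm
  exact ⟨basisOfLinearIndependentOfCardEqFinrank hli hfin, fun i ↦ by simp [hv]⟩

/-- The identification of the Lie algebra of `SU(2)` with `ℝ³`. -/
def algebraEquiv : (Fin 3 → ℝ) ≃ₗ[ℝ] GroupLieAlgebra (𝓡 3) SU2 :=
  exists_algebraBasis.choose.equivFun.symm

lemma dcol_algebraEquiv (a : Fin 3 → ℝ) : dcol 1 (algebraEquiv a) = imag a := by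
  rw [algebraEquiv, Basis.equivFun_symm_apply, map_sum]
  simp only [map_smul, exists_algebraBasis.choose_spec]
  simp only [← map_smul, ← map_sum]
  congr 1
  funext i
  simp [Finset.sum_apply, Pi.single_apply]

/-- The left-invariant vector field with value `a` at the identity. -/
def leftField (a : Fin 3 → ℝ) : Π g : SU2, TangentSpace (𝓡 3) g :=
  mulInvariantVectorField (algebraEquiv a)

lemma isSmoothField_leftField (a : Fin 3 → ℝ) : IsSmoothField (leftField a) :=
  isSmoothField_mulInvariantVectorField _

lemma dcol_leftField (a : Fin 3 → ℝ) (g : SU2) :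
    dcol g (leftField a g) = quatMul (col g.1) (imag a) := by
  rw [leftField, dcol_mulInvariantVectorField, dcol_algebraEquiv]

lemma leftField_add (a b : Fin 3 → ℝ) (g : SU2) :
    leftField (a + b) g = leftField a g + leftField b g := by
  rw [leftField, map_add, mulInvariantVectorField_add]
  rfl

lemma leftField_smul (r : ℝ) (a : Fin 3 → ℝ) (g : SU2) :
    leftField (r • a) g = r • leftField a g := by
  rw [leftField, map_smul, mulInvariantVectorField_smul]
  rfl

/-- Multiplying by `g⁻¹` shows that evaluation at `g` is injective, and both spaces have dimension
three. -/
lemma exists_leftField_eq (g : SU2) (v : TangentSpace (𝓡 3) g) :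
    ∃ a, leftField a g = v := by
  let T : (Fin 3 → ℝ) →ₗ[ℝ] TangentSpace (𝓡 3) g :=
    { toFun := fun a ↦ leftField a g
      map_add' := fun a b ↦ leftField_add a b g
      map_smul' := fun r a ↦ leftField_smul r a g }
  have hq : ∀ a, quatMul (col (g⁻¹).1) (dcol g (T a)) = imag a := by
    intro a
    change quatMul (col (g⁻¹).1) (dcol g (leftField a g)) = imag a
    rw [dcol_leftField, ← quatMul_assoc, ← col_mul, inv_mul_cancel, col_one]
    ext k
    fin_cases k <;> simp [quatMul_apply]
  have hinj : Function.Injective T := fun a b h ↦ imag_injective (by rw [← hq a, ← hq b, h])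
  have hfin : finrank ℝ (Fin 3 → ℝ) = finrank ℝ (TangentSpace (𝓡 3) g) :=
    (finrank_fin_fun ℝ).trans (finrank_euclideanSpace_fin (𝕜 := ℝ) (n := 3)).symm
  have : FiniteDimensional ℝ (TangentSpace (𝓡 3) g) :=
    inferInstanceAs (FiniteDimensional ℝ (EuclideanSpace ℝ (Fin 3)))
  exact (LinearMap.injective_iff_surjective_of_finrank_eq_finrank hfin).1 hinj v

lemma leftField_ne_zero {a : Fin 3 → ℝ} (ha : a ≠ 0) (g : SU2) : leftField a g ≠ 0 := by
  intro h
  refine ha (imag_injective ?_)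
  have h1 := dcol_leftField a g
  rw [h, map_zero] at h1
  have h2 : quatMul (col (g⁻¹).1) (quatMul (col g.1) (imag a)) = imag a := by
    rw [← quatMul_assoc, ← col_mul, inv_mul_cancel, col_one]
    ext k
    fin_cases k <;> simp [quatMul_apply]
  rw [← h2, ← h1, map_zero, map_zero]

/-- The coordinate function `ℓ ∘ col` has derivative `ℓ ∘ dcol`. -/
lemma mvfderiv_linear_col (l : EuclideanSpace ℝ (Fin (3 + 1)) →L[ℝ] ℝ) (g : SU2)
    (v : TangentSpace (𝓡 3) g) :
    mvfderiv (𝓡 3) (fun A : SU2 ↦ l (col A.1)) g v = l (dcol g v) := by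
  have h := mfderiv_comp g (I' := 𝓘(ℝ, EuclideanSpace ℝ (Fin (3 + 1))))
    l.mdifferentiableAt (mdifferentiableAt_col g)
  rw [ContinuousLinearMap.mfderiv_eq] at h
  exact DFunLike.congr_fun h v

/-- Test on the coordinates of `ℝ⁴`: differentiating a linear function along `leftField c`
precomposes it with right multiplication by `imag c`, so the commutator of derivations becomes a
commutator of quaternions. -/
lemma mlieBracket_leftField (a b : Fin 3 → ℝ) (g : SU2) :
    VectorField.mlieBracket (𝓡 3) (leftField a) (leftField b) g
      = leftField ((2 : ℝ) • (a ⨯₃ b)) g := by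
  refine dcol_injective g ?_
  ext k
  let P : EuclideanSpace ℝ (Fin (3 + 1)) →L[ℝ] ℝ := EuclideanSpace.proj k
  have hsm : ∀ l : EuclideanSpace ℝ (Fin (3 + 1)) →L[ℝ] ℝ,
      ContMDiff (𝓡 3) 𝓘(ℝ) ∞ (fun A : SU2 ↦ l (col A.1)) := fun l ↦
    l.contMDiff.comp contMDiff_col
  let R : (Fin 3 → ℝ) → EuclideanSpace ℝ (Fin (3 + 1)) →L[ℝ] ℝ := fun c ↦
    P.comp (quatMul.flip (imag c)).toContinuousLinearMap
  have hR : ∀ c, (fun q : SU2 ↦ mvfderiv (𝓡 3) (fun A : SU2 ↦ P (col A.1)) q (leftField c q))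
      = fun A : SU2 ↦ R c (col A.1) := by
    intro c
    funext q
    rw [mvfderiv_linear_col, dcol_leftField]
    rfl
  have hd : ∀ c, MDifferentiableAt (𝓡 3) 𝓘(ℝ)
      (fun q : SU2 ↦ mvfderiv (𝓡 3) (fun A : SU2 ↦ P (col A.1)) q (leftField c q)) g := by
    intro c
    rw [hR c]
    exact (hsm _ g).mdifferentiableAt (by simp)
  -- Any nowhere vanishing smooth field serves as the auxiliary field; here it is the one with
  -- vector `(1, 1, 1)`.
  have hW := leftField_ne_zero (a := 1) one_ne_zero g
  have h := mvfderiv_mlieBracket (isSmoothField_leftField a) (isSmoothField_leftField b)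
    (isSmoothField_leftField 1) hW (hsm P) (hd a) (hd b)
  rw [hR, hR, mvfderiv_linear_col, mvfderiv_linear_col, mvfderiv_linear_col, dcol_leftField,
    dcol_leftField] at h
  rw [dcol_leftField, ← quatMul_imag_sub, map_sub, ← quatMul_assoc, ← quatMul_assoc]
  exact h

lemma lie_algebraEquiv (a b : Fin 3 → ℝ) :
    ⁅algebraEquiv a, algebraEquiv b⁆ = (2 : ℝ) • algebraEquiv (a ⨯₃ b) := by
  rw [GroupLieAlgebra.bracket_def, ← map_smul]
  refine dcol_injective 1 ?_
  refine (congrArg (dcol 1) (mlieBracket_leftField a b 1)).trans ?_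
  rw [dcol_leftField, dcol_algebraEquiv, col_one]
  ext k
  fin_cases k <;> simp [quatMul_apply]

lemma mfderiv_mul_circleCurve (g : SU2) {a : Fin 3 → ℝ} (ha : a ⬝ᵥ a = 1) (t : ℝ) :
    mfderiv 𝓘(ℝ) (𝓡 3) (fun t ↦ g * circleCurve ha t) t (1 : ℝ)
      = leftField a (g * circleCurve ha t) := by
  refine dcol_injective _ ?_
  have h1 : MDifferentiableAt 𝓘(ℝ) (𝓡 3) (circleCurve ha) t :=
    (contMDiff_circleCurve ha t).mdifferentiableAt (by simp)
  have h2 : MDifferentiableAt (𝓡 3) (𝓡 3) (fun x : SU2 ↦ g * x) (circleCurve ha t) :=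
    (contMDiff_mul_left (I := 𝓡 3) (n := ∞) _).mdifferentiableAt (by simp)
  have h3 := DFunLike.congr_fun (mfderiv_comp t h2 h1) (1 : ℝ)
  refine (congrArg (dcol (g * circleCurve ha t)) h3).trans ?_
  refine (dcol_mfderiv_mul_left g (circleCurve ha t) _).trans ?_
  refine (congrArg (quatMul (col g.1)) (dcol_mfderiv_circleCurve ha t)).trans ?_
  rw [dcol_leftField, col_mul, quatMul_assoc]

/-- The derivative of a function along the orbits of a one-parameter subgroup. -/
lemma hasDerivAt_comp_circleCurve {f : SU2 → ℝ} (g : SU2) {a : Fin 3 → ℝ} (ha : a ⬝ᵥ a = 1)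
    (t : ℝ) (hf : MDifferentiableAt (𝓡 3) 𝓘(ℝ) f (g * circleCurve ha t)) :
    HasDerivAt (fun t ↦ f (g * circleCurve ha t))
      (mvfderiv (𝓡 3) f (g * circleCurve ha t) (leftField a (g * circleCurve ha t))) t := by
  have h1 : MDifferentiableAt 𝓘(ℝ) (𝓡 3) (fun t ↦ g * circleCurve ha t) t :=
    ((contMDiff_mul_left (I := 𝓡 3) (n := ∞)).comp
      (contMDiff_circleCurve ha) t).mdifferentiableAt (by simp)
  have h2 := mfderiv_comp t hf h1
  have h3 : DifferentiableAt ℝ (fun t ↦ f (g * circleCurve ha t)) t :=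
    (hf.comp t h1).differentiableAt
  refine h3.hasDerivAt.congr_deriv ?_
  rw [← mfderiv_mul_circleCurve]
  change fderiv ℝ (fun t ↦ f (g * circleCurve ha t)) t 1 = _
  rw [← mfderiv_eq_fderiv]
  exact DFunLike.congr_fun h2 (1 : ℝ)

end SU2

/-! ### Periodic solutions of a Riccati equation -/

/-- A periodic solution of `u' = k u² + a` with `k > 0` is stationary. -/
lemma riccati_periodic {u : ℝ → ℝ} {T k a : ℝ} (hT : 0 < T) (hper : Function.Periodic u T)
    (hk : 0 < k) (hu : ∀ t, HasDerivAt u (k * u t ^ 2 + a) t) (t : ℝ) :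
    k * u t ^ 2 + a = 0 := by
  have hcont : Continuous u := continuous_iff_continuousAt.2 fun t ↦ (hu t).continuousAt
  have hne : (Set.Icc 0 T).Nonempty := ⟨0, le_refl _, hT.le⟩
  obtain ⟨t₀, -, h₀⟩ := isCompact_Icc.exists_isMaxOn hne hcont.continuousOn
  obtain ⟨t₁, -, h₁⟩ := isCompact_Icc.exists_isMinOn hne hcont.continuousOn
  have hmax : ∀ t, u t ≤ u t₀ := fun t ↦ by
    obtain ⟨y, hy, hty⟩ := hper.exists_mem_Ico₀ hT t
    rw [hty]
    exact h₀ ⟨hy.1, hy.2.le⟩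
  have hmin : ∀ t, u t₁ ≤ u t := fun t ↦ by
    obtain ⟨y, hy, hty⟩ := hper.exists_mem_Ico₀ hT t
    rw [hty]
    exact h₁ ⟨hy.1, hy.2.le⟩
  -- The derivative vanishes at the maximum and at the minimum, so both have the same square, which
  -- bounds `u²`. Thus `u' ≤ 0` everywhere.
  have e₀ : k * u t₀ ^ 2 + a = 0 :=
    IsLocalMax.hasDerivAt_eq_zero (Filter.Eventually.of_forall hmax) (hu t₀)
  have e₁ : k * u t₁ ^ 2 + a = 0 :=
    IsLocalMin.hasDerivAt_eq_zero (Filter.Eventually.of_forall hmin) (hu t₁)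
  have hnonpos : ∀ t, k * u t ^ 2 + a ≤ 0 := by
    intro t
    have h2 : u t ^ 2 ≤ u t₀ ^ 2 := by
      have h3 : u t₀ ^ 2 = u t₁ ^ 2 := mul_left_cancel₀ hk.ne' (by linarith)
      rcases le_total 0 (u t) with h | h
      · exact pow_le_pow_left₀ h (hmax t) 2
      · rw [h3]
        nlinarith [hmin t]
    nlinarith
  have hanti : Antitone u := antitone_of_deriv_nonpos (fun t ↦ (hu t).differentiableAt) fun t ↦ by
    rw [(hu t).deriv]
    exact hnonpos t
  -- A decreasing periodic function is constant: `u t₀ = u (t₀ + n T) ≤ u t ≤ u t₀`.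
  obtain ⟨n, hn⟩ := exists_nat_ge ((t - t₀) / T)
  have hle : t ≤ t₀ + n * T := by
    rw [div_le_iff₀ hT] at hn
    linarith
  have := hanti hle
  rw [hper.nat_mul n t₀] at this
  rw [le_antisymm (hmax t) this, e₀]

/-! ### Milnor frames and the algebraic equations -/

/-- The structure coefficients of a Milnor frame: `[e_i, e_{i+1}] = μ_{i+2} e_{i+2}`. -/
def milnorCoeff (μ : Fin 3 → ℝ) (i j k : Fin 3) : ℝ :=
  if j = i + 1 ∧ k = i + 2 then μ k else if i = j + 1 ∧ k = j + 2 then -μ k else 0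

lemma ricciOf_milnorCoeff (μ : Fin 3 → ℝ) (i j : Fin 3) :
    ricciOf (milnorCoeff μ) i j = if i = j then
      (μ i ^ 2 - (μ (i + 1) - μ (i + 2)) ^ 2) / 2 else 0 := by
  fin_cases i <;> fin_cases j <;>
    simp [ricciOf, christoffelOf, milnorCoeff, Fin.sum_univ_three] <;> ring

/-- This removes the zeroth-order term from the diagonal Lie derivative, leaving a Riccati equation
for a single component of `X`. -/
lemma milnorCoeff_right (μ : Fin 3 → ℝ) (l i : Fin 3) : milnorCoeff μ l i i = 0 := by
  fin_cases l <;> fin_cases i <;> simp [milnorCoeff]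

/-- Only `l = i + 2` contributes: `[e_{i+2}, e_i] = μ_{i+1} e_{i+1}` and `[e_{i+2}, e_{i+1}] = -μ_i
e_i`. -/
lemma sum_milnorCoeff (μ x : Fin 3 → ℝ) (i : Fin 3) :
    ∑ l, x l * (milnorCoeff μ l i (i + 1) + milnorCoeff μ l (i + 1) i)
      = x (i + 2) * (μ (i + 1) - μ i) := by
  fin_cases i <;> simp [milnorCoeff, Fin.sum_univ_three] <;> exact Or.inl (by ring)

/-- The algebraic part of the near-horizon equation has no solutions with three distinct structure
coefficients. -/
lemma not_injective_of_milnor {μ x : Fin 3 → ℝ} {m Λ : ℝ} (hm : 0 < m)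
    (hd : ∀ i, (μ i ^ 2 - (μ (i + 1) - μ (i + 2)) ^ 2) / 2 - 1 / m * (x i * x i) = Λ)
    (ho : ∀ i, x (i + 2) * (μ i - μ (i + 1)) / 2 = 1 / m * (x i * x (i + 1))) :
    ¬ Function.Injective μ := by
  intro hinj
  have h01 : μ 0 - μ 1 ≠ 0 := sub_ne_zero.2 (hinj.ne (by decide))
  have h12 : μ 1 - μ 2 ≠ 0 := sub_ne_zero.2 (hinj.ne (by decide))
  have h20 : μ 2 - μ 0 ≠ 0 := sub_ne_zero.2 (hinj.ne (by decide))
  have o0 : x 2 * (μ 0 - μ 1) / 2 = 1 / m * (x 0 * x 1) := ho 0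
  have o1 : x 0 * (μ 1 - μ 2) / 2 = 1 / m * (x 1 * x 2) := ho 1
  have o2 : x 1 * (μ 2 - μ 0) / 2 = 1 / m * (x 2 * x 0) := ho 2
  have d0 : (μ 0 ^ 2 - (μ 1 - μ 2) ^ 2) / 2 - 1 / m * (x 0 * x 0) = Λ := hd 0
  have d1 : (μ 1 ^ 2 - (μ 2 - μ 0) ^ 2) / 2 - 1 / m * (x 1 * x 1) = Λ := hd 1
  have d2 : (μ 2 ^ 2 - (μ 0 - μ 1) ^ 2) / 2 - 1 / m * (x 2 * x 2) = Λ := hd 2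
  have hk : 0 < 1 / m := by positivity
  set k := 1 / m
  -- Multiply each off-diagonal equation by its own `x_i x_{i+1}` and add: the left sides are `x_0
  -- x_1 x_2 / 2` times the differences of the `μ_i`, which sum to zero.
  have hsum : k * ((x 0 * x 1) ^ 2 + (x 1 * x 2) ^ 2 + (x 2 * x 0) ^ 2) = 0 := by
    linear_combination (-(x 0 * x 1)) * o0 - (x 1 * x 2) * o1 - (x 2 * x 0) * o2
  have hsum' := (mul_eq_zero.1 hsum).resolve_left hk.ne'
  have p0 : x 0 * x 1 = 0 := by
    nlinarith [sq_nonneg (x 0 * x 1), sq_nonneg (x 1 * x 2), sq_nonneg (x 2 * x 0)]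
  have p1 : x 1 * x 2 = 0 := by
    nlinarith [sq_nonneg (x 0 * x 1), sq_nonneg (x 1 * x 2), sq_nonneg (x 2 * x 0)]
  have p2 : x 2 * x 0 = 0 := by
    nlinarith [sq_nonneg (x 0 * x 1), sq_nonneg (x 1 * x 2), sq_nonneg (x 2 * x 0)]
  have x2 : x 2 = 0 := by
    simpa [p0, h01] using o0
  have x0 : x 0 = 0 := by
    simpa [p1, h12] using o1
  have x1 : x 1 = 0 := by
    simpa [p2, h20] using o2
  rw [x0] at d0
  rw [x1] at d1
  rw [x2] at d2
  -- With `x = 0`, the difference of two Ricci coefficients factors as `(μ 0 - μ 1) * (μ 0 + μ 1 - μ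
  -- 2)`.
  have e0 : μ 0 + μ 1 - μ 2 = 0 := mul_left_cancel₀ h01 (by linear_combination d0 - d1)
  have e1 : μ 1 + μ 2 - μ 0 = 0 := mul_left_cancel₀ h12 (by linear_combination d1 - d2)
  have e2 : μ 2 + μ 0 - μ 1 = 0 := mul_left_cancel₀ h20 (by linear_combination d2 - d0)
  exact h01 (by linarith)

/-! ### Oriented orthonormal bases and diagonalisation -/

/-- `s` is a positively oriented orthonormal basis of `ℝ³`. -/
structure IsOrientedOrthonormal (s : Fin 3 → Fin 3 → ℝ) : Prop where
  dot_eq : ∀ i j, s i ⬝ᵥ s j = if i = j then 1 else 0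
  cross_eq : ∀ i, s i ⨯₃ s (i + 1) = s (i + 2)

lemma sum_dotProduct_smul {s : Fin 3 → Fin 3 → ℝ}
    (hs : ∀ i j, s i ⬝ᵥ s j = if i = j then 1 else 0) (x : Fin 3 → ℝ) :
    ∑ i, (x ⬝ᵥ s i) • s i = x := by
  have h1 : Matrix.of s * (Matrix.of s)ᵀ = 1 := by
    ext i j
    rw [Matrix.mul_apply', Matrix.one_apply]
    exact hs i j
  have h2 := mul_eq_one_comm.1 h1
  funext k
  have h3 := congrFun (congrArg (· *ᵥ x) h2) k
  rw [Matrix.one_mulVec] at h3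
  rw [← h3, ← Matrix.mulVec_mulVec]
  simp [Matrix.mulVec, dotProduct, mul_comm, Finset.sum_apply]

namespace IsOrientedOrthonormal

variable {s : Fin 3 → Fin 3 → ℝ}

/-- A cyclic shift keeps the orientation, so a chosen axis can be put last. -/
lemma cyclic (hs : IsOrientedOrthonormal s) (k : Fin 3) :
    IsOrientedOrthonormal fun i ↦ s (i + k) where
  dot_eq i j := by simp [hs.dot_eq]
  cross_eq i := by
    have h := hs.cross_eq (i + k)
    rwa [add_right_comm, add_right_comm i k 2] at h

lemma exists_basis (hs : IsOrientedOrthonormal s) :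
    ∃ b : Basis (Fin 3) ℝ (Fin 3 → ℝ), ⇑b = s := by
  have hli : LinearIndependent ℝ s := by
    rw [Fintype.linearIndependent_iff]
    intro a ha i
    have h := congrArg (· ⬝ᵥ s i) ha
    simpa [sum_dotProduct, hs.dot_eq] using h
  exact ⟨basisOfLinearIndependentOfCardEqFinrank hli (by simp), by simp⟩

end IsOrientedOrthonormal

/-- A symmetric bilinear form on `ℝ³` is diagonal in some positively oriented orthonormal basis. -/
lemma exists_isOrientedOrthonormal_diagonal (B : LinearMap.BilinForm ℝ (Fin 3 → ℝ))
    (hB : ∀ x y, B x y = B y x) :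
    ∃ s, IsOrientedOrthonormal s ∧ ∃ d : Fin 3 → ℝ,
      ∀ i j, B (s i) (s j) = if i = j then d i else 0 := by
  let A : Matrix (Fin 3) (Fin 3) ℝ := LinearMap.BilinForm.toMatrix' B
  have hA : A.IsHermitian := by
    ext i j
    simp [A, LinearMap.BilinForm.toMatrix'_apply, hB]
  let v : Fin 3 → Fin 3 → ℝ := fun i ↦ (hA.eigenvectorBasis i).ofLp
  have hv : ∀ i j, v i ⬝ᵥ v j = if i = j then 1 else 0 := by
    intro i j
    have h := orthonormal_iff_ite.1 hA.eigenvectorBasis.orthonormal j i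
    rw [EuclideanSpace.inner_eq_star_dotProduct] at h
    simpa [v, eq_comm] using h
  have hBv : ∀ i j, B (v i) (v j) = if i = j then hA.eigenvalues j else 0 := by
    intro i j
    have h1 : B (v i) (v j) = v i ⬝ᵥ A *ᵥ v j := by
      have := Matrix.toBilin'_apply' A (v i) (v j)
      rwa [Matrix.toBilin'_toMatrix'] at this
    rw [h1, hA.mulVec_eigenvectorBasis]
    change v i ⬝ᵥ (hA.eigenvalues j • v j) = _
    rw [dotProduct_smul, hv]
    simp
  -- The determinant `D` is `±1`. Scaling all three vectors by `D` corrects the orientation, the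
  -- dimension being odd, and leaves the diagonal entries alone since `D * D = 1`.
  set D := v 0 ⬝ᵥ v 1 ⨯₃ v 2 with hD
  have hcross : ∀ i, v i ⨯₃ v (i + 1) = D • v (i + 2) := by
    have hD1 : v 1 ⬝ᵥ v 2 ⨯₃ v 0 = D :=
      (triple_product_permutation _ _ _).symm
    have hD2 : v 2 ⬝ᵥ v 0 ⨯₃ v 1 = D := triple_product_permutation _ _ _
    intro i
    rw [← sum_dotProduct_smul hv (v i ⨯₃ v (i + 1))]
    fin_cases i <;>
      simp [Fin.sum_univ_three, dotProduct_comm _ (v _), hD1, hD2, ← hD]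
  have hD2 : D * D = 1 := by
    have h1 : (v 0 ⨯₃ v 1) ⬝ᵥ (v 0 ⨯₃ v 1) = 1 := by
      rw [cross_dot_cross]
      simp [hv]
    have h2 : v 0 ⨯₃ v 1 = D • v 2 := hcross 0
    rw [h2, smul_dotProduct, dotProduct_smul, hv] at h1
    simpa using h1
  refine ⟨fun i ↦ D • v i, ⟨fun i j ↦ ?_, fun i ↦ ?_⟩, hA.eigenvalues, fun i j ↦ ?_⟩
  · rw [smul_dotProduct, dotProduct_smul, hv, smul_eq_mul, smul_eq_mul, ← mul_assoc, hD2, one_mul]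
  · simp only [map_smul, LinearMap.smul_apply]
    rw [hcross, smul_smul, smul_smul, hD2, one_mul]
  · simp only [map_smul, LinearMap.smul_apply]
    rw [hBv, smul_eq_mul, smul_eq_mul, ← mul_assoc, hD2, one_mul]
    split_ifs with h
    · rw [h]
    · rfl

/-- Where `f p ≠ 0`, differentiate `f²`; if `f p = 0`, the constant is zero and `f` vanishes
identically. No choice of sign or connectedness enters. -/
lemma mvfderiv_eq_zero_of_sq_const {E H M : Type*} [NormedAddCommGroup E] [NormedSpace ℝ E]
    [TopologicalSpace H] {I : ModelWithCorners ℝ E H} [TopologicalSpace M] [ChartedSpace H M]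
    {f : M → ℝ} {p : M} (hf : MDifferentiableAt I 𝓘(ℝ) f p) {C : ℝ} (h : ∀ q, f q ^ 2 = C) :
    mvfderiv I f p = 0 := by
  by_cases hp : f p = 0
  · have hC : C = 0 := by rw [← h p, hp, zero_pow two_ne_zero]
    have hf0 : f = fun _ ↦ 0 := funext fun q ↦ by
      have := h q
      rwa [hC, sq_eq_zero_iff] at this
    rw [hf0, mvfderiv_const]
  · have h1 : f * f = fun _ ↦ C := funext fun q ↦ by rw [← h q, sq, Pi.mul_apply]
    have h2 := mvfderiv_mul hf hf
    rw [h1, mvfderiv_const, ← two_smul ℝ, smul_smul] at h2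
    exact (smul_eq_zero.1 h2.symm).resolve_left (mul_ne_zero two_ne_zero hp)

/-! ### Principal axes of a left-invariant metric -/

namespace SU2

/-- The inner product at the identity, in terms of the identification of the Lie algebra of
`SU(2)` with `ℝ³`. -/
def algebraForm (γ : SmoothMetric (𝓡 3) SU2) : LinearMap.BilinForm ℝ (Fin 3 → ℝ) :=
  LinearMap.mk₂ ℝ (fun a b ↦ γ.inner 1 (algebraEquiv a) (algebraEquiv b))
    (by simp) (by simp) (by simp) (by simp)

lemma algebraForm_apply (γ : SmoothMetric (𝓡 3) SU2) (a b : Fin 3 → ℝ) :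
    algebraForm γ a b = γ.inner 1 (algebraEquiv a) (algebraEquiv b) := rfl

lemma inner_mulInvariantVectorField {γ : SmoothMetric (𝓡 3) SU2} (hγ : IsLeftInvariantMetric γ)
    (g : SU2) (v w : GroupLieAlgebra (𝓡 3) SU2) :
    γ.inner g (mulInvariantVectorField v g) (mulInvariantVectorField w g) = γ.inner 1 v w := by
  have transport : ∀ (q : SU2) (_ : q = g) (a b : EuclideanSpace ℝ (Fin 3)),
      γ.inner q (a : TangentSpace (𝓡 3) q) (b : TangentSpace (𝓡 3) q)
        = γ.inner g (a : TangentSpace (𝓡 3) g) (b : TangentSpace (𝓡 3) g) := by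
    rintro q rfl a b
    rfl
  exact (transport (g * 1) (mul_one g) _ _).symm.trans (hγ g 1 v w)

lemma inner_leftField {γ : SmoothMetric (𝓡 3) SU2} (hγ : IsLeftInvariantMetric γ)
    (g : SU2) (a b : Fin 3 → ℝ) :
    γ.inner g (leftField a g) (leftField b g) = algebraForm γ a b :=
  inner_mulInvariantVectorField hγ g _ _

lemma exists_principal_axes (γ : SmoothMetric (𝓡 3) SU2) :
    ∃ s, IsOrientedOrthonormal s ∧ ∃ d : Fin 3 → ℝ, (∀ i, 0 < d i) ∧
      (∀ i j, algebraForm γ (s i) (s j) = if i = j then d i else 0) ∧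
      d 0 ≤ d 2 ∧ d 1 ≤ d 2 := by
  obtain ⟨s, hs, d, hd⟩ := exists_isOrientedOrthonormal_diagonal (algebraForm γ)
    fun a b ↦ γ.symm _ _ _
  have hpos : ∀ i, 0 < d i := by
    intro i
    have h : algebraForm γ (s i) (s i) = d i := by rw [hd, if_pos rfl]
    rw [← h]
    refine γ.pos _ _ fun h0 ↦ ?_
    have h1 := hs.dot_eq i i
    rw [algebraEquiv.map_eq_zero_iff.1 h0] at h1
    simp at h1
  obtain ⟨k, hk⟩ := Finite.exists_max d
  -- The shift by `k + 1` sends the index `2` to `k` modulo `3`, so the largest coefficient comes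
  -- last, where the Berger normalisation has `1`.
  refine ⟨fun i ↦ s (i + (k + 1)), hs.cyclic _, fun i ↦ d (i + (k + 1)), fun i ↦ hpos _,
    fun i j ↦ ?_, ?_⟩
  · simp [hd]
  · have h2 : (2 : Fin 3) + (k + 1) = k := by
      rw [add_comm k, ← add_assoc]
      exact zero_add k
    simp only [h2]
    exact ⟨hk _, hk _⟩

section Frame

variable {γ : SmoothMetric (𝓡 3) SU2} {s : Fin 3 → Fin 3 → ℝ} {r : Fin 3 → ℝ}

lemma isOrthonormalFrame_leftField (hγ : IsLeftInvariantMetric γ) (hs : IsOrientedOrthonormal s)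
    (hr : ∀ i, 0 < r i) (hd : ∀ i j, algebraForm γ (s i) (s j) = if i = j then r i ^ 2 else 0) :
    IsOrthonormalFrame γ fun i ↦ leftField ((r i)⁻¹ • s i) := by
  have horth : ∀ i j p, γ.inner p (leftField ((r i)⁻¹ • s i) p) (leftField ((r j)⁻¹ • s j) p)
      = if i = j then 1 else 0 := by
    intro i j p
    rw [inner_leftField hγ, map_smul, map_smul, LinearMap.smul_apply, hd]
    split_ifs with h
    · subst h
      have := (hr i).ne'
      simp only [smul_eq_mul]
      field_simp
    · simp
  refine ⟨fun i ↦ isSmoothField_leftField _, horth, fun p v ↦ ?_⟩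
  have hspan : ∃ c : Fin 3 → ℝ, v = ∑ i, c i • leftField ((r i)⁻¹ • s i) p := by
    obtain ⟨a, rfl⟩ := exists_leftField_eq p v
    refine ⟨fun i ↦ (a ⬝ᵥ s i) * r i, ?_⟩
    have ha := sum_dotProduct_smul hs.dot_eq a
    conv_lhs => rw [← ha]
    simp only [Fin.sum_univ_three, leftField_add, leftField_smul, smul_smul]
    simp only [mul_assoc, mul_inv_cancel₀ (hr _).ne', mul_one]
  obtain ⟨c, rfl⟩ := hspan
  refine Finset.sum_congr rfl fun i _ ↦ ?_
  congr 1
  simp [map_sum, horth]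

/-- For cyclic `i, j, k`, `[s_i / r_i, s_j / r_j] = 2 s_k / (r_i r_j)`; writing `s_k = r_k e_k`
gives the coefficient `2 r_k² / (r_0 r_1 r_2)`. -/
lemma mlieBracket_frame (hs : IsOrientedOrthonormal s) (hr : ∀ i, 0 < r i) (i j : Fin 3)
    (p : SU2) :
    VectorField.mlieBracket (𝓡 3) (leftField ((r i)⁻¹ • s i)) (leftField ((r j)⁻¹ • s j)) p
      = ∑ k, milnorCoeff (fun l ↦ 2 / (r 0 * r 1 * r 2) * r l ^ 2) i j k
          • leftField ((r k)⁻¹ • s k) p := by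
  have h0 := (hr 0).ne'
  have h1 := (hr 1).ne'
  have h2 := (hr 2).ne'
  have c0 : s 0 ⨯₃ s 1 = s 2 := hs.cross_eq 0
  have c1 : s 1 ⨯₃ s 2 = s 0 := hs.cross_eq 1
  have c2 : s 2 ⨯₃ s 0 = s 1 := hs.cross_eq 2
  have c0' : s 1 ⨯₃ s 0 = -s 2 := by rw [← cross_anticomm, c0]
  have c1' : s 2 ⨯₃ s 1 = -s 0 := by rw [← cross_anticomm, c1]
  have c2' : s 0 ⨯₃ s 2 = -s 1 := by rw [← cross_anticomm, c2]
  rw [mlieBracket_leftField]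
  simp only [map_smul, LinearMap.smul_apply, leftField_smul, Fin.sum_univ_three]
  fin_cases i <;> fin_cases j <;>
    simp only [Fin.zero_eta, Fin.mk_one, Fin.reduceFinMk, c0, c1, c2, c0', c1', c2', cross_self] <;>
    simp only [← neg_one_smul ℝ (s _), ← zero_smul ℝ (s 0), leftField_smul, smul_smul] <;>
    simp [milnorCoeff] <;> congr 1 <;> field_simp

end Frame

/-! ### The near-horizon equation forces two equal coefficients -/

section NearHorizon

variable {γ : SmoothMetric (𝓡 3) SU2} {s : Fin 3 → Fin 3 → ℝ} {r : Fin 3 → ℝ}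

/-- A left-invariant metric on `SU(2)` with three distinct principal coefficients does not solve the
near-horizon equation. -/
lemma not_injective_of_solvesNearHorizon (hγ : IsLeftInvariantMetric γ)
    (hs : IsOrientedOrthonormal s) (hr : ∀ i, 0 < r i)
    (hd : ∀ i j, algebraForm γ (s i) (s j) = if i = j then r i ^ 2 else 0)
    {X : Π p : SU2, TangentSpace (𝓡 3) p} (hX : IsSmoothField X) {m Λ : ℝ} (hm : 0 < m)
    (hsol : SolvesNearHorizon γ X m Λ) : ¬ Function.Injective r := by
  obtain ⟨nabla, hLC, heq⟩ := hsol
  set κ := 2 / (r 0 * r 1 * r 2)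
  set μ : Fin 3 → ℝ := fun l ↦ κ * r l ^ 2
  set e : Fin 3 → Π p : SU2, TangentSpace (𝓡 3) p := fun i ↦ leftField ((r i)⁻¹ • s i)
  have he : IsOrthonormalFrame γ e := isOrthonormalFrame_leftField hγ hs hr hd
  have hc : ∀ i j p, VectorField.mlieBracket (𝓡 3) (e i) (e j) p
      = ∑ k, milnorCoeff μ i j k • e k p := mlieBracket_frame hs hr
  have hframe : ∀ i j p, ricciOf (milnorCoeff μ) i j
      + 1 / 2 * (mvfderiv (𝓡 3) (γ.pair X (e j)) p (e i p)
        + mvfderiv (𝓡 3) (γ.pair X (e i)) p (e j p)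
        - ∑ l, γ.pair X (e l) p * (milnorCoeff μ l i j + milnorCoeff μ l j i))
      - 1 / m * (γ.pair X (e i) p * γ.pair X (e j) p) = Λ * if i = j then 1 else 0 := by
    intro i j p
    have h := heq (e i) (e j) (he.smooth i) (he.smooth j) p
    rwa [hLC.ricciAt_frame he hc, he.lieDerivMetricAt_frame hc (hX.fieldDiffAt p),
      congrFun (he.pair_eq i j) p] at h
  have hdiff : ∀ i p, MDifferentiableAt (𝓡 3) 𝓘(ℝ) (γ.pair X (e i)) p := fun i p ↦
    γ.mdifferentiableAt_pair (hX.fieldDiffAt p) ((he.smooth i).fieldDiffAt p)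
  set a : Fin 3 → ℝ := fun i ↦ Λ - (μ i ^ 2 - (μ (i + 1) - μ (i + 2)) ^ 2) / 2 with ha
  have hriccati : ∀ i p, mvfderiv (𝓡 3) (γ.pair X (e i)) p (e i p)
      = 1 / m * γ.pair X (e i) p ^ 2 + a i := by
    intro i p
    have h := hframe i i p
    simp only [milnorCoeff_right, ricciOf_milnorCoeff, if_true, add_zero, mul_zero,
      Finset.sum_const_zero] at h
    rw [ha]
    linarith
  -- Restrict to the closed orbit of `e i` through `g`. The circle is traversed with velocity `s i =
  -- r i • e i` as a left-invariant field, hence the factor `r i` in the Riccati equation.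
  have hsq : ∀ i g, γ.pair X (e i) g ^ 2 = -(m * a i) := by
    intro i g
    have hunit : s i ⬝ᵥ s i = 1 := by rw [hs.dot_eq, if_pos rfl]
    have hri := (hr i).ne'
    have hu : ∀ t, HasDerivAt (fun t ↦ γ.pair X (e i) (g * circleCurve hunit t))
        (r i / m * γ.pair X (e i) (g * circleCurve hunit t) ^ 2 + r i * a i) t := by
      intro t
      refine (hasDerivAt_comp_circleCurve g hunit t (hdiff i _)).congr_deriv ?_
      have h := hriccati i (g * circleCurve hunit t)
      rw [show e i (g * circleCurve hunit t) = (r i)⁻¹ • leftField (s i) (g * circleCurve hunit t)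
        from leftField_smul _ _ _, map_smul, smul_eq_mul] at h
      rw [inv_mul_eq_iff_eq_mul₀ hri] at h
      rw [h]
      ring
    have hper : Function.Periodic (fun t ↦ γ.pair X (e i) (g * circleCurve hunit t))
        (2 * Real.pi) := fun t ↦ by
      simp only [circleCurve_periodic hunit t]
    have h := riccati_periodic Real.two_pi_pos hper (div_pos (hr i) hm) hu 0
    simp only [circleCurve_zero, mul_one] at h
    have h' : r i * (γ.pair X (e i) g ^ 2 + m * a i) = 0 := by
      have := hm.ne'
      field_simp at h
      exact mul_eq_zero.2 (Or.inr (by simpa [hri] using h))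
    linarith [(mul_eq_zero.1 h').resolve_left hri]
  have hconst : ∀ i p, mvfderiv (𝓡 3) (γ.pair X (e i)) p = 0 := fun i p ↦
    mvfderiv_eq_zero_of_sq_const (hdiff i p) (hsq i)
  -- All derivative terms are now gone, so the equation at the single point `1` gives the algebraic
  -- system.
  have hno : ¬ Function.Injective μ := by
    refine not_injective_of_milnor (x := fun i ↦ γ.pair X (e i) 1) (Λ := Λ) hm
      (fun i ↦ ?_) (fun i ↦ ?_)
    · have h := hriccati i 1
      rw [hconst] at h
      simp only [ha, _root_.zero_apply] at h
      linarith
    · have h := hframe i (i + 1) 1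
      have hi : i ≠ i + 1 := by fin_cases i <;> decide
      rw [hconst, hconst, ricciOf_milnorCoeff, if_neg hi, if_neg hi,
        sum_milnorCoeff μ (fun l ↦ γ.pair X (e l) 1)] at h
      simp only [_root_.zero_apply] at h
      linarith
  refine fun hinj ↦ hno fun i j hij ↦ hinj ?_
  have hκpos : 0 < κ := by
    have := hr 0
    have := hr 1
    have := hr 2
    positivity
  exact (pow_left_inj₀ (hr i).le (hr j).le two_ne_zero).1 (mul_left_cancel₀ hκpos.ne' hij)

end NearHorizon

/-! ### The Berger form, and right translations by a circle -/

lemma isBergerMetric_of_principal_axes {γ : SmoothMetric (𝓡 3) SU2}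
    (hγ : IsLeftInvariantMetric γ) {s : Fin 3 → Fin 3 → ℝ} {r : Fin 3 → ℝ}
    (hs : IsOrientedOrthonormal s) (hr : ∀ i, 0 < r i)
    (hd : ∀ i j, algebraForm γ (s i) (s j) = if i = j then r i ^ 2 else 0)
    (h0 : r 0 ≤ r 2) (h1 : r 1 ≤ r 2) (hrep : r 1 = r 2 ∨ r 0 = r 2 ∨ r 0 = r 1) :
    IsBergerMetric γ := by
  obtain ⟨b, hb⟩ := hs.exists_basis
  have h2 := hr 2
  refine ⟨r 2 ^ 2, r 0 / r 2, r 1 / r 2, b.map algebraEquiv, by positivity,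
    ⟨div_pos (hr 0) h2, (div_le_one h2).2 h0⟩, ⟨div_pos (hr 1) h2, (div_le_one h2).2 h1⟩,
    fun i ↦ ?_, fun g i j ↦ ?_, ?_⟩
  · simp only [Basis.map_apply, hb]
    rw [lie_algebraEquiv, hs.cross_eq]
  · simp only [Basis.map_apply, hb]
    rw [inner_mulInvariantVectorField hγ, ← algebraForm_apply, hd]
    split_ifs with h
    · have := h2.ne'
      fin_cases i <;> simp <;> field_simp
    · rfl
  · rcases hrep with h | h | h
    · exact Or.inl (by rw [h, div_self h2.ne'])
    · exact Or.inr (Or.inl (by rw [h, div_self h2.ne']))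
    · exact Or.inr (Or.inr (by rw [h]))

/-- The rotation of `ℝ³` about the axis `a` given by conjugation with `x - y a`. -/
def rodrigues (a : Fin 3 → ℝ) (x y : ℝ) (b : Fin 3 → ℝ) : Fin 3 → ℝ :=
  (x ^ 2 - y ^ 2) • b - (2 * x * y) • (a ⨯₃ b) + (2 * y ^ 2 * (a ⬝ᵥ b)) • a

lemma rodrigues_apply (a : Fin 3 → ℝ) (x y : ℝ) (b : Fin 3 → ℝ) (i : Fin 3) :
    rodrigues a x y b i
      = (x ^ 2 - y ^ 2) * b i - 2 * x * y * (a ⨯₃ b) i + 2 * y ^ 2 * (a ⬝ᵥ b) * a i := rfl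

/-- This is conjugation, `q⁻¹ (imag b) q = imag (rodrigues a x y b)`, written without the inverse of
the rotor `q`. -/
lemma quatMul_imag_rotor {a : Fin 3 → ℝ} (ha : a ⬝ᵥ a = 1) {x y : ℝ}
    (hxy : x ^ 2 + y ^ 2 = 1) (b : Fin 3 → ℝ) :
    quatMul (imag b) (rotor a x y) = quatMul (rotor a x y) (imag (rodrigues a x y b)) := by
  simp only [dotProduct, Fin.sum_univ_three] at ha
  ext i
  fin_cases i <;>
    simp [quatMul_apply, imag_apply, rotor, rodrigues_apply, cross_apply, dotProduct,
      Fin.sum_univ_three]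
  · linear_combination y * (a 0 * b 0 + a 1 * b 1 + a 2 * b 2) * hxy
      + 2 * y ^ 3 * (a 0 * b 0 + a 1 * b 1 + a 2 * b 2) * ha
  · linear_combination (x * b 0 - y * (a 1 * b 2 - a 2 * b 1)) * hxy + 2 * x * y ^ 2 * b 0 * ha
  · linear_combination (x * b 1 - y * (a 2 * b 0 - a 0 * b 2)) * hxy + 2 * x * y ^ 2 * b 1 * ha
  · linear_combination (x * b 2 - y * (a 0 * b 1 - a 1 * b 0)) * hxy + 2 * x * y ^ 2 * b 2 * ha

lemma dotProduct_rodrigues {a : Fin 3 → ℝ} (ha : a ⬝ᵥ a = 1) {x y : ℝ}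
    (hxy : x ^ 2 + y ^ 2 = 1) (b : Fin 3 → ℝ) : a ⬝ᵥ rodrigues a x y b = a ⬝ᵥ b := by
  simp only [rodrigues, dotProduct_add, dotProduct_sub, dotProduct_smul, dot_self_cross, ha,
    smul_eq_mul]
  linear_combination (a ⬝ᵥ b) * hxy

lemma rodrigues_dotProduct_rodrigues {a : Fin 3 → ℝ} (ha : a ⬝ᵥ a = 1) {x y : ℝ}
    (hxy : x ^ 2 + y ^ 2 = 1) (b c : Fin 3 → ℝ) :
    rodrigues a x y b ⬝ᵥ rodrigues a x y c = b ⬝ᵥ c := by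
  have h1 : (a ⨯₃ b) ⬝ᵥ (a ⨯₃ c) = b ⬝ᵥ c - (a ⬝ᵥ b) * (a ⬝ᵥ c) := by
    rw [cross_dot_cross, ha, one_mul, dotProduct_comm b a, mul_comm (a ⬝ᵥ c)]
  have h2 : b ⬝ᵥ (a ⨯₃ c) = -((a ⨯₃ b) ⬝ᵥ c) := by
    rw [← cross_anticomm, dotProduct_neg, triple_product_permutation, dotProduct_comm]
  have h3 : (a ⨯₃ b) ⬝ᵥ a = 0 := by rw [dotProduct_comm, dot_self_cross]
  simp only [rodrigues, dotProduct_add, dotProduct_sub, dotProduct_smul, add_dotProduct,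
    sub_dotProduct, smul_dotProduct, dot_self_cross, ha, smul_eq_mul, h1, h2, h3,
    dotProduct_comm b a]
  linear_combination (b ⬝ᵥ c) * (x ^ 2 + y ^ 2 + 1) * hxy

/-- Since `g (imag b) q = (g q) (q⁻¹ (imag b) q)`, right translation by `q` carries a left-invariant
field to one with rotated vector. -/
lemma mfderiv_mul_rot {a : Fin 3 → ℝ} (ha : a ⬝ᵥ a = 1) {x y : ℝ}
    (hxy : x ^ 2 + y ^ 2 = 1) (b : Fin 3 → ℝ) (g : SU2) :
    mfderiv (𝓡 3) (𝓡 3) (fun q ↦ q * rot ha x y hxy) g (leftField b g)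
      = leftField (rodrigues a x y b) (g * rot ha x y hxy) := by
  refine dcol_injective _ ?_
  rw [dcol_mfderiv_mul_right, dcol_leftField, dcol_leftField, col_mul, col_rot, quatMul_assoc,
    quatMul_imag_rotor ha hxy, quatMul_assoc]

/-- The form sees only dot products and components along `a`, and a rotation about `a` preserves
both. -/
lemma preservesMetric_mul_rot {γ : SmoothMetric (𝓡 3) SU2} (hγ : IsLeftInvariantMetric γ)
    {a : Fin 3 → ℝ} (ha : a ⬝ᵥ a = 1) {α β : ℝ}
    (hform : ∀ b c, algebraForm γ b c = α * (b ⬝ᵥ c) + β * ((a ⬝ᵥ b) * (a ⬝ᵥ c)))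
    {x y : ℝ} (hxy : x ^ 2 + y ^ 2 = 1) :
    PreservesMetric γ fun q ↦ q * rot ha x y hxy := by
  intro g v w
  obtain ⟨b, rfl⟩ := exists_leftField_eq g v
  obtain ⟨c, rfl⟩ := exists_leftField_eq g w
  rw [mfderiv_mul_rot, mfderiv_mul_rot, inner_leftField hγ, inner_leftField hγ, hform, hform,
    rodrigues_dotProduct_rodrigues ha hxy, dotProduct_rodrigues ha hxy,
    dotProduct_rodrigues ha hxy]

/-- After subtracting `d (k + 1)` times the dot product, only the `s k` direction is left. -/
lemma algebraForm_eq_of_axes {γ : SmoothMetric (𝓡 3) SU2} {s : Fin 3 → Fin 3 → ℝ}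
    {d : Fin 3 → ℝ} (hs : IsOrientedOrthonormal s)
    (hd : ∀ i j, algebraForm γ (s i) (s j) = if i = j then d i else 0) {k : Fin 3}
    (hk : d (k + 1) = d (k + 2)) (b c : Fin 3 → ℝ) :
    algebraForm γ b c = d (k + 1) * (b ⬝ᵥ c)
      + (d k - d (k + 1)) * ((s k ⬝ᵥ b) * (s k ⬝ᵥ c)) := by
  have h1 : algebraForm γ b c = ∑ i, d i * ((b ⬝ᵥ s i) * (c ⬝ᵥ s i)) := by
    conv_lhs => rw [← sum_dotProduct_smul hs.dot_eq b, ← sum_dotProduct_smul hs.dot_eq c]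
    simp only [Fin.sum_univ_three, map_add, map_smul, LinearMap.add_apply, LinearMap.smul_apply,
      hd]
    simp
    ring
  have h2 : b ⬝ᵥ c = ∑ i, (b ⬝ᵥ s i) * (c ⬝ᵥ s i) := by
    conv_lhs => rw [← sum_dotProduct_smul hs.dot_eq c]
    simp only [Fin.sum_univ_three, dotProduct_add, dotProduct_smul, smul_eq_mul]
    ring
  rw [h1, h2, dotProduct_comm (s k), dotProduct_comm (s k)]
  fin_cases k <;> simp [Fin.sum_univ_three] at hk ⊢ <;> rw [hk] <;> ring

lemma circle_re_sq_add_im_sq (z : Circle) : (z : ℂ).re ^ 2 + (z : ℂ).im ^ 2 = 1 := by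
  rw [sq, sq, ← Complex.normSq_apply, Circle.normSq_coe]

/-- The circle subgroup of `SU(2)` with axis `a`. -/
def circleHom {a : Fin 3 → ℝ} (ha : a ⬝ᵥ a = 1) : Circle →* SU2 :=
  MonoidHom.mk' (fun z ↦ rot ha (z : ℂ).re (z : ℂ).im (circle_re_sq_add_im_sq z)) fun z w ↦ by
      refine col_injective ?_
      simp only [dotProduct, Fin.sum_univ_three] at ha
      simp only [col_mul, col_rot]
      ext i
      fin_cases i <;> simp [quatMul_apply, rotor]
      · linear_combination (z : ℂ).im * (w : ℂ).im * ha
      all_goals ring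

lemma col_circleHom {a : Fin 3 → ℝ} (ha : a ⬝ᵥ a = 1) (z : Circle) :
    col (circleHom ha z).1 = rotor a (z : ℂ).re (z : ℂ).im := col_mat _

lemma contMDiff_circleHom {a : Fin 3 → ℝ} (ha : a ⬝ᵥ a = 1) :
    ContMDiff (𝓡 1) (𝓡 3) ∞ (circleHom ha) := by
  apply contMDiff_of_col
  simp only [col_circleHom]
  have := Complex.finrank_real_complex_fact
  have h1 : ContMDiff (𝓡 1) 𝓘(ℝ, ℂ) ∞ (fun z : Circle ↦ (z : ℂ)) := contMDiff_coe_sphere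
  have h2 : ContDiff ℝ ∞ fun z : ℂ ↦ rotor a z.re z.im := by
    simp only [rotor_eq]
    exact (Complex.reCLM.contDiff.smul contDiff_const).add
      (Complex.imCLM.contDiff.smul contDiff_const)
  exact h2.contMDiff.comp h1

lemma coe_circleHom_of_eq_neg_one {a : Fin 3 → ℝ} (ha : a ⬝ᵥ a = 1) {z : Circle}
    (hz : (z : ℂ) = -1) : (circleHom ha z : Matrix (Fin 2) (Fin 2) ℂ) = -1 := by
  rw [← mat_col (circleHom ha z), col_circleHom, hz]
  ext i j
  fin_cases i <;> fin_cases j <;> simp [mat, rotor, Complex.ext_iff]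

/-- Commuting with the unit quaternion `imag b` gives `Im z • (a ⨯₃ b) = 0`. If `Im z ≠ 0`, taking
`b` among the coordinate vectors makes `a` vanish. -/
lemma im_eq_zero_of_central {a : Fin 3 → ℝ} (ha : a ⬝ᵥ a = 1) {z : Circle}
    (h : ∀ x, circleHom ha z * x = x * circleHom ha z) : (z : ℂ).im = 0 := by
  by_contra him
  have hcross : ∀ i : Fin 3, a ⨯₃ Pi.single i 1 = 0 := by
    intro i
    have hb : (Pi.single i 1 : Fin 3 → ℝ) ⬝ᵥ Pi.single i 1 = 1 := by simp
    have h1 := congrArg (fun A : SU2 ↦ col A.1) (h (rot hb 0 1 (by norm_num)))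
    simp only [col_mul, col_circleHom, col_rot, rotor_eq, zero_smul, one_smul, zero_add, map_add,
      map_smul, LinearMap.add_apply, LinearMap.smul_apply] at h1
    have h2 : ∀ b : Fin 3 → ℝ, quatMul !₂[1, 0, 0, 0] (imag b)
        = quatMul (imag b) !₂[1, 0, 0, 0] := by
      intro b
      ext k
      fin_cases k <;> simp [quatMul_apply]
    rw [h2, add_right_inj] at h1
    have h3 := quatMul_imag_sub a (Pi.single i 1)
    rw [smul_right_injective _ him h1, sub_self] at h3
    have h4 := imag_injective (h3.symm.trans (map_zero imag).symm)
    exact (smul_eq_zero.1 h4).resolve_left two_ne_zero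
  have h0 := hcross 0
  have h1 := hcross 1
  simp [cross_apply] at h0 h1
  simp [dotProduct, Fin.sum_univ_three, h0, h1] at ha

/-- At `x = 1` a trivial action gives `g = circleHom ha z`; the other `x` then make this element
central, so `z` is real and hence `±1`. -/
lemma circle_action_trivial_iff {a : Fin 3 → ℝ} (ha : a ⬝ᵥ a = 1) (g : SU2) (z : Circle) :
    (∀ x, g * x * (circleHom ha z)⁻¹ = x) ↔ (g = 1 ∧ z = 1) ∨
      ((g : Matrix (Fin 2) (Fin 2) ℂ) = -1 ∧ (z : ℂ) = -1) := by
  constructor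
  · intro h
    have hg : g = circleHom ha z := by simpa [mul_inv_eq_one] using h 1
    have him := im_eq_zero_of_central ha fun x ↦ by
      rw [← hg, ← mul_inv_eq_iff_eq_mul, hg]
      simpa [hg] using h x
    have hre : (z : ℂ).re * (z : ℂ).re = 1 := by
      have h1 := Circle.normSq_coe z
      rwa [Complex.normSq_apply, him, mul_zero, add_zero] at h1
    rcases mul_self_eq_one_iff.1 hre with h1 | h1
    · have hz : z = 1 := Circle.ext (Complex.ext (by simpa using h1) (by simpa using him))
      exact Or.inl ⟨by rw [hg, hz, map_one], hz⟩
    · have hz : (z : ℂ) = -1 := Complex.ext (by simpa using h1) (by simpa using him)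
      exact Or.inr ⟨by rw [hg, coe_circleHom_of_eq_neg_one ha hz], hz⟩
  · rintro (⟨rfl, rfl⟩ | ⟨hg, hz⟩) x
    · simp
    · have h1 : circleHom ha z = g :=
        Subtype.ext ((coe_circleHom_of_eq_neg_one ha hz).trans hg.symm)
      have h2 : g * x = x * g := Subtype.ext (by
        change g.1 * x.1 = x.1 * g.1
        rw [hg, neg_one_mul, mul_neg_one])
      rw [h1, h2, mul_inv_cancel_right]

lemma mulLeft_mem_isometryGroup {γ : SmoothMetric (𝓡 3) SU2} (hγ : IsLeftInvariantMetric γ)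
    (g : SU2) : Equiv.mulLeft g ∈ isometryGroup γ :=
  ⟨contMDiff_mul_left (I := 𝓡 3) (n := ∞),
    contMDiff_mul_left (I := 𝓡 3) (n := ∞) (a := g⁻¹), hγ g⟩

lemma mulRight_circleHom_mem_isometryGroup {γ : SmoothMetric (𝓡 3) SU2}
    (hγ : IsLeftInvariantMetric γ) {a : Fin 3 → ℝ} (ha : a ⬝ᵥ a = 1) {α β : ℝ}
    (hform : ∀ b c, algebraForm γ b c = α * (b ⬝ᵥ c) + β * ((a ⬝ᵥ b) * (a ⬝ᵥ c))) (z : Circle) :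
    Equiv.mulRight (circleHom ha z) ∈ isometryGroup γ :=
  ⟨contMDiff_mul_right (I := 𝓡 3) (n := ∞),
    contMDiff_mul_right (I := 𝓡 3) (n := ∞) (a := (circleHom ha z)⁻¹),
    preservesMetric_mul_rot hγ ha hform (circle_re_sq_add_im_sq z)⟩

lemma isometryGroupContainsSU2U1_of_form {γ : SmoothMetric (𝓡 3) SU2}
    (hγ : IsLeftInvariantMetric γ) {a : Fin 3 → ℝ} (ha : a ⬝ᵥ a = 1) {α β : ℝ}
    (hform : ∀ b c, algebraForm γ b c = α * (b ⬝ᵥ c) + β * ((a ⬝ᵥ b) * (a ⬝ᵥ c))) :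
    IsometryGroupContainsSU2U1 γ := by
  let Φ : SU2 × Circle →* isometryGroup γ :=
    MonoidHom.mk' (fun q ↦ ⟨Equiv.mulLeft q.1 * (Equiv.mulRight (circleHom ha q.2))⁻¹,
      mul_mem (mulLeft_mem_isometryGroup hγ q.1)
        (inv_mem (mulRight_circleHom_mem_isometryGroup hγ ha hform q.2))⟩) fun q q' ↦ by
      refine Subtype.ext (Equiv.ext fun x ↦ ?_)
      simp [mul_assoc]
  have hΦ : ∀ q x, (Φ q : Equiv.Perm SU2) x = q.1 * x * (circleHom ha q.2)⁻¹ := fun q x ↦ by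
    simp [Φ, mul_assoc]
  refine ⟨Φ, ?_, fun g x ↦ by simp [hΦ], fun g z ↦ ?_⟩
  · simp only [hΦ]
    have h1 : ContMDiff (((𝓡 3).prod (𝓡 1)).prod (𝓡 3)) (𝓡 3) ∞
        (fun q : (SU2 × Circle) × SU2 ↦ q.1.1 * q.2) :=
      (contMDiff_fst.comp contMDiff_fst).mul contMDiff_snd
    exact h1.mul ((contMDiff_circleHom ha).comp (contMDiff_snd.comp contMDiff_fst)).inv
  · rw [← circle_action_trivial_iff ha, Subtype.ext_iff, Equiv.ext_iff]
    simp only [hΦ]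
    rfl

end SU2

end

theorem theorem1p1 (γ : SmoothMetric (𝓡 3) SU2) (hγ : IsLeftInvariantMetric γ)
    (X : Π p : SU2, TangentSpace (𝓡 3) p) (hX : IsSmoothField X)
    (m Λ : ℝ) (hm : 0 < m) (hsol : SolvesNearHorizon γ X m Λ) :
    IsometryGroupContainsSU2U1 γ ∧ IsBergerMetric γ := by
  obtain ⟨s, hs, d, hpos, hd, h02, h12⟩ := SU2.exists_principal_axes γ
  set r : Fin 3 → ℝ := fun i ↦ √(d i)
  have hr : ∀ i, 0 < r i := fun i ↦ Real.sqrt_pos.2 (hpos i)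
  have hr2 : ∀ i, r i ^ 2 = d i := fun i ↦ Real.sq_sqrt (hpos i).le
  have hdr : ∀ i j, SU2.algebraForm γ (s i) (s j) = if i = j then r i ^ 2 else 0 := fun i j ↦ by
    rw [hd, hr2]
  -- Equal coefficients are indexed by the remaining axis `k`, which becomes the axis of the circle.
  have hrep : ∃ k, r (k + 1) = r (k + 2) := by
    by_contra! h
    refine SU2.not_injective_of_solvesNearHorizon hγ hs hr hdr hX hm hsol fun i j hij ↦ ?_
    have h0 : r 1 ≠ r 2 := h 0
    have h1 : r 2 ≠ r 0 := h 1
    have h2 : r 0 ≠ r 1 := h 2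
    fin_cases i <;> fin_cases j <;>
      first
      | rfl
      | exact absurd hij h0
      | exact absurd hij h1
      | exact absurd hij h2
      | exact absurd hij h0.symm
      | exact absurd hij h1.symm
      | exact absurd hij h2.symm
  obtain ⟨k, hk⟩ := hrep
  constructor
  · have hunit : s k ⬝ᵥ s k = 1 := by rw [hs.dot_eq, if_pos rfl]
    exact SU2.isometryGroupContainsSU2U1_of_form hγ hunit
      (SU2.algebraForm_eq_of_axes hs hd (by rw [← hr2, ← hr2, hk]))
  · refine SU2.isBergerMetric_of_principal_axes hγ hs hr hdr (Real.sqrt_le_sqrt h02)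
      (Real.sqrt_le_sqrt h12) ?_
    fin_cases k
    · exact Or.inl hk
    · exact Or.inr (Or.inl hk.symm)
    · exact Or.inr (Or.inr hk)
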